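/- **Setting.** Let $(S,o)$ be a germ of smooth complex surface, and let $(L,L')$ be a pair of transversal smooth branches on it, $L=Z(x)$, $L'=Z(y)$ for some local coordinates $(x,y)$. Curves are formal: a *branch* is an ideal generated by an irreducible element of $\hat{\mathcal O}_{S,o}\simeq\mathbb C[[x,y]]$, and a *reduced curve* is an ideal generated by a nonzero square-free non-unit. Let $(e_1,e_2)$ be the basis of the weight lattice $\mathbb Z^2$ in which $e_1$, $e_2$ correspond to $x$, $y$. Let $w=c_we_1+d_we_2$ be a primitive lattice vector with $c_w,d_w>0$, and let $\pi_w:S_w\to S$ be the toric modification, relative to $(L,L')$, obtained by subdividing the cone $\mathbb R_+\langle e_1,e_2\rangle$ along the ray $\mathbb R_+w$. Let $E_w$ be its exceptional divisor, and let $o_w\in E_w$ be a point which is not on the strict transforms of $L$ and $L'$. **Eggers–Wall trees.** For a local coordinate system $(x,y)$ with $L=Z(x)$ and a branch $A\ne L$, let $\mathcal Z_x(A)$ be the finite set of Newton–Puiseux roots of $A$, i.e. the series $\eta\in\bigcup_n\mathbb C[[x^{1/n}]]$ without constant term at which the defining functions of $A$ vanish. Let $\nu_x$ be the order in $x$. Set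 $k_x(A,B)=\max\{\nu_x(\xi-\xi'):\xi\in\mathcal Z_x(A),\ \xi'\in\mathcal Z_x(B)\}$ for branches $A\neq B$ other than $L$, and $k_x(A,L)=k_x(L,A)=0$. The characteristic exponents of $A$ are the numbers $\nu_x(\xi-\xi')$ for $\xi\ne\xi'$ in $\mathcal Z_x(A)$. The tree $\Theta_{o,L}(C)$ of a reduced curve $C$ is obtained from the disjoint union of one segment $[0,\infty]$ for each branch $A\neq L$ of $C$ (and the single point $0$ for $L$, if $L$ is a branch of $C$) by identifying points with equal parameters at most $k_x(A,B)$ on the segments of $A$ and $B$. The parameter is the exponent function $\mathbf e_L$; the root is the point where $\mathbf e_L=0$. The index $\mathbf i_L$ at the point of exponent $s$ of the segment of $A$ is the least common multiple of the denominators of the characteristic exponents of $A$ that are $<s$. The contact complexity is $\mathbf c_L(P)=\int_L^P d\mathbf e_L/\mathbf i_L$. The trees $\Theta_{o_w,E_w}$ are defined in the same way on $(S_w,o_w)$ relative to $E_w=Z(x_1)$. Any coordinate systems with $L=Z(x)$, resp. $E_w=Z(x_1)$, may be used. **Proposition.** Let $C_w$ be a reduced curve on $(S_w,o_w)$ which does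 not contain $E_w$. Then its image by $\pi_w$ is a reduced curve on $(S,o)$. Let $C$ be any reduced curve on $(S,o)$ which contains this image (for instance the image itself, or any reduced curve whose strict transform at $o_w$ is $C_w$). 1. There is a unique map $\iota:\Theta_{o_w,E_w}(C_w)\to\Theta_{o,L}(C)$ (the *natural embedding*) such that, for each branch $A_w$ of $C_w$, the image $A$ of $A_w$ is a branch of $C$ and $\iota$ sends each point $Q$ of the segment of $A_w$ to a point $Q'$ of the segment of $A$ with $\mathbf c_L(Q')=\frac1{c_w^2}\mathbf c_{E_w}(Q)+\frac{d_w}{c_w}$. The map $\iota$ is injective. 2. After identifying $\Theta_{o_w,E_w}(C_w)$ with a subtree of $\Theta_{o,L}(C)$ by $\iota$, one has on this subtree $$\mathbf i_L=c_w\,\mathbf i_{E_w}\ \text{ at every point other than the root } E_w,\qquad \mathbf e_L=\frac1{c_w}\,\mathbf e_{E_w}+\frac{d_w}{c_w}\ \text{ everywhere};$$ at the root $E_w$ one has $\mathbf i_L=\mathbf i_{E_w}=1$. 3. In terms of orders of coincidence: for any two distinct branches $A_w,B_w$ of $C_w$ with images $A,B$, $$k_x(A,B)=\frac{d_w}{c_w}+\frac1{c_w}\,k_{x_1}(A_w,B_w).$$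 -/

import Mathlib

open scoped ENNReal

noncomputable section

namespace EggersWall

/-! ### Formal germs of surfaces, curves and branches -/

/-- The ring `ℂ[[x, y]]`; the variables are numbered `x = X 0`, `y = X 1`. -/
abbrev FormalPlane : Type := MvPowerSeries (Fin 2) ℂ

/-- A formal local coordinate system on a smooth germ of surface `(S, o)` whose completed local
ring is `R`: an isomorphism `ℂ[[x, y]] ≃ R`. The two coordinates are the images of `X 0`, `X 1`. -/
abbrev Coordinates (R : Type*) [CommRing R] [Algebra ℂ R] : Type _ := FormalPlane ≃ₐ[ℂ] R

section Curves

variable {R : Type*} [CommRing R]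

/-- A branch: a principal ideal generated by an irreducible element of the completed local ring. -/
def IsBranch (A : Ideal R) : Prop := ∃ g : R, Irreducible g ∧ A = Ideal.span {g}

/-- A reduced plane curve singularity: a principal ideal generated by a (nonzero) square-free
non-unit of the completed local ring. -/
def IsReducedCurve (C : Ideal R) : Prop :=
  ∃ f : R, f ≠ 0 ∧ ¬ IsUnit f ∧ Squarefree f ∧ C = Ideal.span {f}

/-- The branches of the curve `C`: if `C = (f)`, these are the ideals `(g)` with `g` an irreducible
divisor of `f`. -/
def Branch (C : Ideal R) : Type _ := {A : Ideal R // IsBranch A ∧ C ≤ A}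

end Curves

/-! ### Newton-Puiseux series -/

/-- The exponents `k ↦ k / n` of the powers of `x ^ (1 / n)`. -/
def exponentEmbedding (n : ℕ+) : ℕ ↪o ℚ :=
  OrderEmbedding.ofStrictMono (fun k : ℕ => (k : ℚ) / (n : ℕ)) (by
    intro k l h
    have hn : (0 : ℚ) < ((n : ℕ) : ℚ) := by exact_mod_cast n.pos
    have hkl : (k : ℚ) < (l : ℚ) := by exact_mod_cast h
    exact div_lt_div_of_pos_right hkl hn)

/-- The Newton-Puiseux series `ζ (x ^ (1 / n))`, as a formal series in `x` with rational
exponents. -/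
def puiseux (n : ℕ+) (ζ : PowerSeries ℂ) : HahnSeries ℚ ℂ :=
  HahnSeries.embDomain (exponentEmbedding n) (HahnSeries.toPowerSeries.symm ζ)

/-- The order of a series in `x`: the smallest exponent of its terms, and `∞` for the zero
series. -/
def orderX (η : HahnSeries ℚ ℂ) : ℝ≥0∞ :=
  open Classical in if η = 0 then ⊤ else ENNReal.ofReal (η.order : ℝ)

section Trees

variable {R : Type*} [CommRing R] [Algebra ℂ R]

/-- The smooth branch `Z(x)`, where `x` is the first coordinate of the system `φ`. -/
def firstAxis (φ : Coordinates R) : Ideal R := Ideal.span {φ (MvPowerSeries.X 0)}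

/-- The Newton-Puiseux roots of `A` in the coordinate system `φ = (x, y)`: the series
`ζ (x ^ (1 / n))` without constant term such that `g (x, ζ (x ^ (1 / n))) = 0`, that is
`g (t ^ n, ζ (t)) = 0`, for all `g` in the ideal of `A`. -/
def roots (φ : Coordinates R) (A : Ideal R) : Set (HahnSeries ℚ ℂ) :=
  {η | ∃ (n : ℕ+) (ζ : PowerSeries ℂ), PowerSeries.constantCoeff ζ = 0 ∧ η = puiseux n ζ ∧
    ∀ g ∈ A, (MvPowerSeries.subst ![(PowerSeries.X : PowerSeries ℂ) ^ (n : ℕ), ζ] (φ.symm g) :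
      PowerSeries ℂ) = 0}

/-- The order of coincidence of two branches: the maximal order of the difference of a
Newton-Puiseux root of the first one and a Newton-Puiseux root of the second one. -/
def coincidence (φ : Coordinates R) (A B : Ideal R) : ℝ≥0∞ :=
  ⨆ ξ ∈ roots φ A, ⨆ ξ' ∈ roots φ B, orderX (ξ - ξ')

/-- The characteristic exponents of a branch: the orders of coincidence of pairs of distinct
Newton-Puiseux roots of it. -/
def charExponents (φ : Coordinates R) (A : Ideal R) : Set ℚ :=
  {q | ∃ ξ ∈ roots φ A, ∃ ξ' ∈ roots φ A, ξ ≠ ξ' ∧ q = (ξ - ξ').order}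

/-- The index function on the segment of the branch `A`, at the point of exponent `s`: the least
common multiple of the denominators of the characteristic exponents which are `< s`. -/
def indexOn (φ : Coordinates R) (A : Ideal R) (s : ℝ≥0∞) : ℕ :=
  sInf {N : ℕ | 0 < N ∧ ∀ q ∈ charExponents φ A, ENNReal.ofReal (q : ℝ) < s → q.den ∣ N}

/-- The contact complexity on the segment of the branch `A`, at the point of exponent `s`: the
integral of `1 / (index)` with respect to the exponent, from `0` to `s`. -/
def contactOn (φ : Coordinates R) (A : Ideal R) (s : ℝ≥0∞) : ℝ≥0∞ :=
  ∫⁻ t in {t : ℝ | 0 < t ∧ ENNReal.ofReal t < s}, ((indexOn φ A (ENNReal.ofReal t) : ℕ) : ℝ≥0∞)⁻¹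

/-- The disjoint union of the segments of the branches of `C`. The segment of a branch `A` other
than `L = Z(x)` is identified with `[0, ∞]` by its exponent function, and that of `L` is reduced
to the point of exponent `0`. -/
@[ext]
structure SegmentPoint (φ : Coordinates R) (C : Ideal R) where
  branch : Branch C
  exponent : ℝ≥0∞
  exponent_eq_zero : branch.1 = firstAxis φ → exponent = 0

/-- Two points of the disjoint union of the segments are to be identified when they have the same
exponent and when it is not greater than the order of coincidence of the two branches. -/
def Identified (φ : Coordinates R) (C : Ideal R) (p q : SegmentPoint φ C) : Prop :=
  p.exponent = q.exponent ∧ p.exponent ≤ coincidence φ p.branch.1 q.branch.1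

/-- The Eggers-Wall tree of the curve `C`, computed in the coordinate system `φ = (x, y)`,
relative to the smooth branch `L = Z(x)`. -/
def Tree (φ : Coordinates R) (C : Ideal R) : Type _ := Quot (Identified φ C)

/-- The point of the tree represented by a point of the segment of a branch. -/
def Tree.mk {φ : Coordinates R} {C : Ideal R} (p : SegmentPoint φ C) : Tree φ C :=
  Quot.mk _ p

/-- The exponent function on the tree. The root is the point of exponent `0`. -/
def Tree.exponent {φ : Coordinates R} {C : Ideal R} (P : Tree φ C) : ℝ≥0∞ :=
  Quot.lift (fun p : SegmentPoint φ C => p.exponent) (fun _ _ h => h.1) P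

/-- The index function on the tree, glued from the index functions of the segments (these agree
at identified points; taking the infimum over the points of the segments which represent `P`
avoids a choice among them). -/
def Tree.index {φ : Coordinates R} {C : Ideal R} (P : Tree φ C) : ℕ :=
  sInf {i | ∃ p : SegmentPoint φ C, Tree.mk p = P ∧ i = indexOn φ p.branch.1 p.exponent}

/-- The contact complexity function on the tree, glued in the same way. -/
def Tree.contact {φ : Coordinates R} {C : Ideal R} (P : Tree φ C) : ℝ≥0∞ :=
  sInf {k | ∃ p : SegmentPoint φ C, Tree.mk p = P ∧ k = contactOn φ p.branch.1 p.exponent}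

end Trees

/-! ### The toric modification along a ray -/

/-- A weight vector `w = c e₁ + d e₂` in the interior of the cone `σ₀ = ℝ₊⟨e₁, e₂⟩`, together with
a vector `w' = a e₁ + b e₂` of `σ₀` such that `(w, w')` is a positively oriented basis of the
lattice. Such a `w'` exists if and only if `w` is primitive. -/
structure Weight where
  c : ℕ
  d : ℕ
  a : ℕ
  b : ℕ
  c_pos : 0 < c
  d_pos : 0 < d
  basis : b * c = a * d + 1

/-- The images of the coordinates `x`, `y` in `ℂ[[u, v - γ]]`. In the chart `ℂ²_{u,v}` of the cone
`ℝ₊⟨w, w'⟩` the toric morphism is `x = u ^ c v ^ a`, `y = u ^ d v ^ b`. Here `X 0` is `u` and `X 1`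
is `v - γ`. -/
def chartMap (w : Weight) (γ : ℂ) : Fin 2 → FormalPlane :=
  ![MvPowerSeries.X 0 ^ w.c * (MvPowerSeries.C γ + MvPowerSeries.X 1) ^ w.a,
    MvPowerSeries.X 0 ^ w.d * (MvPowerSeries.C γ + MvPowerSeries.X 1) ^ w.b]

theorem hasSubst_chartMap (w : Weight) (γ : ℂ) : MvPowerSeries.HasSubst (chartMap w γ) := by
  apply MvPowerSeries.hasSubst_of_constantCoeff_zero
  intro s
  fin_cases s
  · simp [chartMap, w.c_pos.ne']
  · simp [chartMap, w.d_pos.ne']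

/-- Let `κ = (x, y)` be a coordinate system on `(S, o)` which defines the cross
`(L, L') = (Z(x), Z(y))`. Let `π_w` be the modification of `S` obtained by subdividing `σ₀` along
the ray `ℝ₊ w`, and `E_w` its exceptional divisor. In the chart `ℂ²_{u,v}` of the cone
`ℝ₊⟨w, w'⟩`, the points of `E_w` outside the strict transforms of `L` and `L'` (the orbit of
dimension one of the ray `ℝ₊ w`) are the points `(0, γ)` with `γ ≠ 0`. At such a point `o_w` the
completed local ring of `S_w` is `ℂ[[u, v - γ]]`, and this is the morphism
`π_w^* : R → ℂ[[u, v - γ]]`. -/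
def pullback {R : Type*} [CommRing R] [Algebra ℂ R] (κ : Coordinates R) (w : Weight) (γ : ℂ) :
    R →ₐ[ℂ] FormalPlane :=
  (MvPowerSeries.substAlgHom (hasSubst_chartMap w γ)).comp (κ.symm : R →ₐ[ℂ] FormalPlane)

/-- The germ at `o_w` of the exceptional divisor, `E_w = Z(u)`. -/
def exceptional : Ideal FormalPlane := Ideal.span {MvPowerSeries.X 0}

section Image

variable {R : Type*} [CommRing R] [Algebra ℂ R]

/-- The image by `π_w` of a curve of the germ `(S_w, o_w)`: it is defined by the functions on
`(S, o)` whose pullback vanishes on the given curve. -/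
def image (κ : Coordinates R) (w : Weight) (γ : ℂ) (Cw : Ideal FormalPlane) : Ideal R :=
  Cw.comap (pullback κ w γ)

/-- The map `ι` is the natural embedding of the Eggers-Wall tree of `C_w` in that of `C`: for each
branch `A_w` of `C_w`, with image `A`, it sends each point `Q` of the segment of `A_w` to a point
`Q'` of the segment of `A` such that `c_L (Q') = c_{E_w} (Q) / c_w ^ 2 + d_w / c_w`. -/
def IsNaturalEmbedding (κ : Coordinates R) (w : Weight) (γ : ℂ)
    (φ : Coordinates R) (ψ : Coordinates FormalPlane)
    (C : Ideal R) (Cw : Ideal FormalPlane) (ι : Tree ψ Cw → Tree φ C) : Prop :=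
  ∀ Aw : Branch Cw, ∃ A : Branch C, A.1 = image κ w γ Aw.1 ∧
    ∀ Q : SegmentPoint ψ Cw, Q.branch = Aw →
      ∃ Q' : SegmentPoint φ C, Q'.branch = A ∧ ι (Tree.mk Q) = Tree.mk Q' ∧
        (Tree.mk Q').contact = (Tree.mk Q).contact / (w.c : ℝ≥0∞) ^ 2 + (w.d : ℝ≥0∞) / w.c

end Image

end EggersWall

end

/-!
The proof describes everything through arcs, that is homomorphisms of `ℂ`-algebras to `ℂ⟦t⟧` which
send `x` to a power `t ^ n`. The Newton-Puiseux roots of a branch `A` are the series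
`y (x ^ (1 / n))` given by the arcs which vanish on the ideal of `A` (`mem_roots_iff`).

The theorem of Newton and Puiseux (`newton_puiseux_of_monic`) together with the Weierstrass
preparation theorem provides an arc on every branch other than `Z(x)`. An irreducible series
generates the ideal of functions which vanish on any of its arcs (`dvd_of_arc`), hence `ℂ⟦x, y⟧` is
factorial; conversely, the functions vanishing on an arc form the ideal of a branch
(`isBranch_ker`).
The norm of `y - ζ (t)` over `ℂ⟦t ^ n⟧` shows that the roots of a branch form one orbit of the
monodromy `x ^ q ↦ exp (2 π i q) x ^ q` (`exists_eq_twist`).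

The orders of coincidence, the characteristic exponents, and hence the index and the contact
complexity, depend only on the sets `contacts` of orders of the differences of roots. These depend
on the axis `Z(x)` but not on the coordinates (`contacts_eq_of_firstAxis_eq`), so that one may
compute at `o_w` in coordinates `(u₁, v₁)` adapted to the toric morphism, in which it takes the form
`x = u₁ ^ c`, `y = u₁ ^ d (γ₁ + v₁)` with `γ₁ ≠ 0` (`exists_adapted_coordinates`). A root
`v₁ = ζ (u₁ ^ (1 / n))` then gives the root `x ^ (d / c) (γ₁ + ζ (x ^ (1 / (n c))))` of the image,
and all the roots of the image are obtained from it by monodromy. Two such roots whose initial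
coefficients are equal differ by a series of order `s / c + d / c`, where `s` is a contact at `o_w`;
if the initial coefficients are different, the order is `d / c`. This is `contacts_image`.

Consequently `s ↦ s / c + d / c` transforms the orders of coincidence (`coincidence_image`), and it
transforms the characteristic exponents up to the new exponent `d / c`, which has denominator `c`.
This gives the index (`indexOn_image`) and, by a change of variable in the integral, the contact
complexity (`contactOn_image`). Since the contact complexity is strictly increasing on each segment,
the natural embedding must send the point of exponent `s` of the segment of a branch to the point
of exponent `s / c + d / c` of the segment of its image (`IsNaturalEmbedding.apply_mk`); that map is
compatible with the identifications and injective because of the formula for the orders of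
coincidence and because distinct branches have distinct images (`image_injective`).

The image of a reduced curve is the intersection of the images of its branches, which is principal
because the local ring is factorial (`exists_comap_eq_span`).
-/

noncomputable section

namespace EggersWall

open PowerSeries (X C constantCoeff expand)

/-! ### Homomorphisms of rings of formal power series -/

/-- Let the `ℂ`-algebra `S` be the sum of the constants and of the ideal generated by `G`. Two
homomorphisms which agree modulo `J` on `G`, one of which sends `G` into `I`, agree modulo
`J + I ^ k` for every `k`. This replaces continuity: homomorphisms of rings of formal power series
are automatically determined by the images of the variables. -/
theorem algHom_sub_mem {S B : Type*} [CommRing S] [Algebra ℂ S] [CommRing B] [Algebra ℂ B]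
    {G : Set S} (hG : ∀ f : S, ∃ c : ℂ, f - algebraMap ℂ S c ∈ Ideal.span G) {I J : Ideal B}
    (p q : S →ₐ[ℂ] B) (hI : ∀ g ∈ G, q g ∈ I) (hJ : ∀ g ∈ G, p g - q g ∈ J) (k : ℕ) (f : S) :
    p f - q f ∈ J ⊔ I ^ k := by
  induction k generalizing f with
  | zero => simp
  | succ k ih =>
    have key : ∀ h ∈ Ideal.span G, p h - q h ∈ J ⊔ I ^ (k + 1) := by
      intro h hh
      refine Submodule.span_induction (p := fun h _ => p h - q h ∈ J ⊔ I ^ (k + 1))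
        ?_ ?_ ?_ ?_ hh
      · intro g hg
        exact Ideal.mem_sup_left (hJ g hg)
      · simp
      · intro a b _ _ ha hb
        rw [map_add, map_add, add_sub_add_comm]
        exact add_mem ha hb
      · intro a g hg ih'
        have hq : q g ∈ I := by
          refine Submodule.span_induction (p := fun g _ => q g ∈ I) hI ?_ ?_ ?_ hg
          · simp
          · intro a b _ _ ha hb
            rw [map_add]
            exact add_mem ha hb
          · intro a b _ hb
            rw [smul_eq_mul, map_mul]
            exact I.mul_mem_left _ hb
        have e : p (a • g) - q (a • g) = p a * (p g - q g) + (p a - q a) * q g := by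
          rw [smul_eq_mul, map_mul, map_mul]; ring
        rw [e]
        refine add_mem (Ideal.mul_mem_left _ _ ih') ?_
        have h1 := Ideal.mul_mem_mul (ih a) hq
        rw [Ideal.sup_mul, ← pow_succ] at h1
        exact (sup_le_sup Ideal.mul_le_left le_rfl : _ ≤ J ⊔ I ^ (k + 1)) h1
    obtain ⟨c, hc⟩ := hG f
    have := key _ hc
    simpa using this

theorem powerSeries_sub_mem_span (f : PowerSeries ℂ) :
    ∃ c : ℂ, f - algebraMap ℂ (PowerSeries ℂ) c ∈ Ideal.span {(X : PowerSeries ℂ)} := by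
  refine ⟨constantCoeff f, ?_⟩
  rw [Ideal.mem_span_singleton, PowerSeries.X_dvd_iff]
  simp

/-- The identification of `ℂ⟦x, y⟧` with `ℂ⟦x⟧⟦y⟧`; it sends `x` to the constant `C X` and `y` to
the variable `X`. -/
def planeEquiv : FormalPlane ≃ₐ[ℂ] PowerSeries (PowerSeries ℂ) :=
  (MvPowerSeries.renameEquiv ℂ
    (⟨![some (), none], fun o => o.elim 1 (fun _ => 0), fun i => by fin_cases i <;> rfl,
      fun o => by cases o <;> rfl⟩ : Fin 2 ≃ Option Unit)).trans
    (MvPowerSeries.optionEquivLeft Unit ℂ)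

theorem planeEquiv_X_zero : planeEquiv (MvPowerSeries.X 0) = C X := by
  rw [planeEquiv, AlgEquiv.trans_apply]
  erw [MvPowerSeries.rename_X]
  exact MvPowerSeries.optionEquivLeft_X_some ()

theorem planeEquiv_X_one : planeEquiv (MvPowerSeries.X 1) = X := by
  rw [planeEquiv, AlgEquiv.trans_apply]
  erw [MvPowerSeries.rename_X]
  exact MvPowerSeries.optionEquivLeft_X_none

theorem planeEquiv_symm_C_X : planeEquiv.symm (C X) = MvPowerSeries.X 0 := by
  rw [← planeEquiv_X_zero, AlgEquiv.symm_apply_apply]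

theorem planeEquiv_symm_X : planeEquiv.symm X = MvPowerSeries.X 1 := by
  rw [← planeEquiv_X_one, AlgEquiv.symm_apply_apply]

theorem formalPlane_sub_mem_span (f : FormalPlane) :
    ∃ c : ℂ, f - algebraMap ℂ FormalPlane c ∈
      Ideal.span (Set.range (MvPowerSeries.X : Fin 2 → FormalPlane)) := by
  have hF := PowerSeries.eq_X_mul_shift_add_const (planeEquiv f)
  set F' := PowerSeries.mk fun p => PowerSeries.coeff (p + 1) (planeEquiv f)
  set f0 := constantCoeff (planeEquiv f)
  obtain ⟨c, hc⟩ := powerSeries_sub_mem_span f0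
  obtain ⟨f0', hf0'⟩ := Ideal.mem_span_singleton.1 hc
  refine ⟨c, ?_⟩
  have e : f - algebraMap ℂ FormalPlane c = MvPowerSeries.X 1 * planeEquiv.symm F' +
      MvPowerSeries.X 0 * planeEquiv.symm (C f0') := by
    apply planeEquiv.injective
    rw [map_sub, map_add, map_mul, map_mul, AlgEquiv.apply_symm_apply, AlgEquiv.apply_symm_apply,
      planeEquiv_X_zero, planeEquiv_X_one, AlgEquiv.commutes, ← map_mul, ← hf0', hF, map_sub]
    have : algebraMap ℂ (PowerSeries (PowerSeries ℂ)) c = C (algebraMap ℂ (PowerSeries ℂ) c) := by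
      simp [PowerSeries.algebraMap_apply]
    rw [this]; ring
  rw [e]
  exact add_mem (Ideal.mul_mem_right _ _ (Ideal.subset_span ⟨1, rfl⟩))
    (Ideal.mul_mem_right _ _ (Ideal.subset_span ⟨0, rfl⟩))

theorem mem_sup_iff_pow_dvd {m : ℕ} {f : PowerSeries ℂ} :
    f ∈ Ideal.span {(X : PowerSeries ℂ) ^ m} ⊔ Ideal.span {(X : PowerSeries ℂ)} ^ m ↔
      X ^ m ∣ f := by
  rw [Ideal.span_singleton_pow, sup_idem, Ideal.mem_span_singleton]

/-- A homomorphism from the formal plane to `ℂ⟦t⟧` is local. -/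
theorem constantCoeff_algHom_X (p : FormalPlane →ₐ[ℂ] PowerSeries ℂ) (i : Fin 2) :
    constantCoeff (p (MvPowerSeries.X i)) = 0 := by
  by_contra hc
  set c := constantCoeff (p (MvPowerSeries.X i)) with hc'
  have hu : IsUnit (MvPowerSeries.X i - algebraMap ℂ FormalPlane c) := by
    rw [MvPowerSeries.isUnit_iff_constantCoeff, MvPowerSeries.algebraMap_apply]
    simpa using hc
  have := hu.map p
  rw [PowerSeries.isUnit_iff_constantCoeff, map_sub, AlgHom.commutes,
    PowerSeries.algebraMap_apply] at this
  simp [← hc'] at this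

theorem eq_of_pow_dvd_sub {f g : PowerSeries ℂ} (h : ∀ m : ℕ, X ^ m ∣ f - g) : f = g := by
  ext k
  have := (PowerSeries.X_pow_dvd_iff.1 (h (k + 1))) k (Nat.lt_succ_self k)
  rwa [map_sub, sub_eq_zero] at this

theorem pow_dvd_arc_sub {p q : FormalPlane →ₐ[ℂ] PowerSeries ℂ} {m : ℕ}
    (h : ∀ i, X ^ m ∣ p (MvPowerSeries.X i) - q (MvPowerSeries.X i)) (f : FormalPlane) :
    X ^ m ∣ p f - q f := by
  rw [← mem_sup_iff_pow_dvd]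
  refine algHom_sub_mem formalPlane_sub_mem_span p q ?_ ?_ m f
  · rintro _ ⟨i, rfl⟩
    rw [Ideal.mem_span_singleton, PowerSeries.X_dvd_iff]
    exact constantCoeff_algHom_X q i
  · rintro _ ⟨i, rfl⟩
    exact Ideal.mem_span_singleton.2 (h i)

theorem arc_ext {p q : FormalPlane →ₐ[ℂ] PowerSeries ℂ}
    (h : ∀ i, p (MvPowerSeries.X i) = q (MvPowerSeries.X i)) : p = q := by
  ext1 f
  exact eq_of_pow_dvd_sub fun m => pow_dvd_arc_sub (fun i => by simp [h i]) f

theorem pow_dvd_endo_sub {p q : PowerSeries ℂ →ₐ[ℂ] PowerSeries ℂ} {m : ℕ}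
    (hq : constantCoeff (q X) = 0) (h : X ^ m ∣ p X - q X) (f : PowerSeries ℂ) :
    X ^ m ∣ p f - q f := by
  rw [← mem_sup_iff_pow_dvd]
  refine algHom_sub_mem powerSeries_sub_mem_span p q ?_ ?_ m f
  · rintro _ rfl
    rwa [Ideal.mem_span_singleton, PowerSeries.X_dvd_iff]
  · rintro _ rfl
    exact Ideal.mem_span_singleton.2 h

theorem endo_ext {p q : PowerSeries ℂ →ₐ[ℂ] PowerSeries ℂ}
    (hq : constantCoeff (q X) = 0) (h : p X = q X) : p = q := by
  ext1 f
  exact eq_of_pow_dvd_sub fun m => pow_dvd_endo_sub hq (by simp [h]) f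

theorem mem_span_X_of_constantCoeff_eq_zero {g : FormalPlane}
    (hg : MvPowerSeries.constantCoeff g = 0) :
    g ∈ Ideal.span (Set.range (MvPowerSeries.X : Fin 2 → FormalPlane)) := by
  obtain ⟨c, hc⟩ := formalPlane_sub_mem_span g
  have hle : Ideal.span (Set.range (MvPowerSeries.X : Fin 2 → FormalPlane)) ≤
      RingHom.ker (MvPowerSeries.constantCoeff (σ := Fin 2) (R := ℂ)) := by
    rw [Ideal.span_le]
    rintro _ ⟨i, rfl⟩
    simp [RingHom.mem_ker]
  have h0 := hle hc
  rw [RingHom.mem_ker, map_sub, hg, MvPowerSeries.algebraMap_apply] at h0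
  have : c = 0 := by simpa using h0
  simpa [this] using hc

theorem constantCoeff_plane_endo {p : FormalPlane →ₐ[ℂ] FormalPlane}
    (hp : ∀ i, MvPowerSeries.constantCoeff (p (MvPowerSeries.X i)) = 0) (f : FormalPlane) :
    MvPowerSeries.constantCoeff (p f) = MvPowerSeries.constantCoeff f := by
  set c := MvPowerSeries.constantCoeff f with hc
  have h1 : f - algebraMap ℂ FormalPlane c ∈
      Ideal.span (Set.range (MvPowerSeries.X : Fin 2 → FormalPlane)) :=
    mem_span_X_of_constantCoeff_eq_zero (by simp [MvPowerSeries.algebraMap_apply, hc])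
  have hle : Ideal.span (Set.range (MvPowerSeries.X : Fin 2 → FormalPlane)) ≤
      (RingHom.ker (MvPowerSeries.constantCoeff (σ := Fin 2) (R := ℂ))).comap p := by
    rw [Ideal.span_le]
    rintro _ ⟨i, rfl⟩
    exact hp i
  have h2 := hle h1
  rw [Ideal.mem_comap, RingHom.mem_ker, map_sub, map_sub, AlgHom.commutes,
    MvPowerSeries.algebraMap_apply] at h2
  simpa [sub_eq_zero] using h2

theorem plane_endo_ext {p q : FormalPlane →ₐ[ℂ] FormalPlane}
    (hq : ∀ i, MvPowerSeries.constantCoeff (q (MvPowerSeries.X i)) = 0)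
    (h : ∀ i, p (MvPowerSeries.X i) = q (MvPowerSeries.X i)) : p = q := by
  ext1 f
  refine sub_eq_zero.1 (IsHausdorff.haus
    (inferInstance : IsHausdorff (Ideal.span (Set.range
      (MvPowerSeries.X : Fin 2 → FormalPlane))) FormalPlane) _ fun n => ?_)
  rw [SModEq.zero, smul_eq_mul, Ideal.mul_top]
  have := algHom_sub_mem (J := ⊥) formalPlane_sub_mem_span p q
    (I := Ideal.span (Set.range (MvPowerSeries.X : Fin 2 → FormalPlane)))
    (by rintro _ ⟨i, rfl⟩; exact mem_span_X_of_constantCoeff_eq_zero (hq i))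
    (by rintro _ ⟨i, rfl⟩; simp [h i]) n f
  rwa [bot_sup_eq] at this

/-- The homomorphism `x ↦ f`, `y ↦ g`; the last clause compares it with the substitution which
defines the Newton-Puiseux roots. -/
theorem exists_arc (f g : PowerSeries ℂ) (hf : constantCoeff f = 0) (hg : constantCoeff g = 0) :
    ∃ p : FormalPlane →ₐ[ℂ] PowerSeries ℂ, p (MvPowerSeries.X 0) = f ∧ p (MvPowerSeries.X 1) = g ∧
      ∀ F, p F = MvPowerSeries.subst ![f, g] F := by
  have hs : MvPowerSeries.HasSubst (![f, g] : Fin 2 → PowerSeries ℂ) := by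
    apply MvPowerSeries.hasSubst_of_constantCoeff_zero
    intro i
    fin_cases i
    · exact hf
    · exact hg
  refine ⟨MvPowerSeries.substAlgHom hs, ?_, ?_, fun F => ?_⟩
  · exact MvPowerSeries.substAlgHom_X hs 0
  · exact MvPowerSeries.substAlgHom_X hs 1
  · rw [MvPowerSeries.substAlgHom_apply]

theorem exists_endo (f : PowerSeries ℂ) (hf : constantCoeff f = 0) :
    ∃ p : PowerSeries ℂ →ₐ[ℂ] PowerSeries ℂ, p X = f ∧ ∀ F, p F = PowerSeries.subst f F := by
  have hs : PowerSeries.HasSubst f := PowerSeries.HasSubst.of_constantCoeff_zero' hf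
  exact ⟨PowerSeries.substAlgHom hs, PowerSeries.substAlgHom_X hs,
    fun F => by rw [PowerSeries.coe_substAlgHom]⟩

theorem constantCoeff_endo (p : PowerSeries ℂ →ₐ[ℂ] PowerSeries ℂ) (f : PowerSeries ℂ)
    (hp : constantCoeff (p X) = 0) : constantCoeff (p f) = constantCoeff f := by
  obtain ⟨c, hc⟩ := powerSeries_sub_mem_span f
  obtain ⟨g, hg⟩ := Ideal.mem_span_singleton.1 hc
  obtain rfl : f = X * g + algebraMap ℂ (PowerSeries ℂ) c := by rw [← hg]; ring
  rw [map_add, map_mul, AlgHom.commutes]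
  simp [hp]

/-- Roots of power series with non-zero constant coefficient. -/
theorem exists_pow_eq {n : ℕ} (hn : n ≠ 0) (e : PowerSeries ℂ) (c : ℂ) (hc : c ≠ 0)
    (h : c ^ n = constantCoeff e) : ∃ r : PowerSeries ℂ, r ^ n = e ∧ constantCoeff r = c := by
  have hH : HenselianRing (PowerSeries ℂ) (Ideal.span {(X : PowerSeries ℂ)}) := inferInstance
  have hmem : ∀ f : PowerSeries ℂ, f ∈ Ideal.span {(X : PowerSeries ℂ)} ↔ constantCoeff f = 0 := by
    intro f; rw [Ideal.mem_span_singleton, PowerSeries.X_dvd_iff]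
  obtain ⟨r, hr, hr'⟩ := hH.is_henselian (Polynomial.X ^ n - Polynomial.C e)
    (Polynomial.monic_X_pow_sub_C e hn) (C c) (by rw [hmem]; simp [h]) (by
      apply IsUnit.map
      rw [PowerSeries.isUnit_iff_constantCoeff]
      simp [Polynomial.derivative_X_pow, hn, hc])
  rw [Polynomial.IsRoot.def] at hr
  rw [hmem] at hr'
  refine ⟨r, ?_, ?_⟩
  · simpa [sub_eq_zero] using hr
  · simpa [sub_eq_zero] using hr'

/-- A unit is determined by its `n`-th power and its constant term, with the same precision. -/
theorem pow_dvd_sub_of_pow {n m : ℕ} (hn : n ≠ 0) {r s : PowerSeries ℂ}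
    (h : constantCoeff r = constantCoeff s) (h0 : constantCoeff r ≠ 0)
    (hrs : X ^ m ∣ r ^ n - s ^ n) : X ^ m ∣ r - s := by
  rw [← Commute.mul_geom_sum₂ (Commute.all r s)] at hrs
  have hu : IsUnit (∑ i ∈ Finset.range n, r ^ i * s ^ (n - 1 - i)) := by
    rw [PowerSeries.isUnit_iff_constantCoeff, map_sum]
    have : ∀ i ∈ Finset.range n, constantCoeff (r ^ i * s ^ (n - 1 - i)) =
        constantCoeff r ^ (n - 1) := by
      intro i hi
      rw [map_mul, map_pow, map_pow, ← h, ← pow_add]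
      congr 1
      have := Finset.mem_range.1 hi
      omega
    rw [Finset.sum_congr rfl this]
    simp [hn, h0]
  exact (hu.dvd_mul_right).1 hrs

/-! ### The theorem of Newton and Puiseux -/

/-- The homomorphism `ℂ⟦x⟧ → ℂ⟦t⟧`, `x ↦ t ^ n`. -/
abbrev ramify (n : ℕ) (hn : n ≠ 0) : PowerSeries ℂ →+* PowerSeries ℂ :=
  (expand n hn : PowerSeries ℂ →ₐ[ℂ] PowerSeries ℂ)

/-- The value of a polynomial in `y` on the arc `x = t ^ n`, `y = ζ (t)`. -/
theorem arc_planeEquiv_symm_coe (p : FormalPlane →ₐ[ℂ] PowerSeries ℂ) {n : ℕ} (hn : n ≠ 0)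
    (hp : p (MvPowerSeries.X 0) = X ^ n) (P : Polynomial (PowerSeries ℂ)) :
    p (planeEquiv.symm (P : PowerSeries (PowerSeries ℂ))) =
      P.eval₂ (ramify n hn) (p (MvPowerSeries.X 1)) := by
  have hC : ∀ a : PowerSeries ℂ, p (planeEquiv.symm (C a)) = expand n hn a := by
    have hcomm : ∀ c : ℂ, (C : PowerSeries ℂ →+* PowerSeries (PowerSeries ℂ))
        (algebraMap ℂ (PowerSeries ℂ) c) = algebraMap ℂ (PowerSeries (PowerSeries ℂ)) c := by
      intro c
      simp [PowerSeries.algebraMap_apply]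
    set i : PowerSeries ℂ →ₐ[ℂ] PowerSeries (PowerSeries ℂ) := ⟨C, hcomm⟩
    have : (p.comp (planeEquiv.symm : PowerSeries (PowerSeries ℂ) →ₐ[ℂ] FormalPlane)).comp i =
        expand n hn := by
      apply endo_ext
      · simp [hn]
      · have : i X = C X := rfl
        simp [this, planeEquiv_symm_C_X, hp]
    exact fun a => DFunLike.congr_fun this a
  have key : ((p : FormalPlane →+* PowerSeries ℂ).comp
      ((planeEquiv.symm : PowerSeries (PowerSeries ℂ) ≃+* FormalPlane).toRingHom.comp
        Polynomial.coeToPowerSeries.ringHom)) =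
      Polynomial.eval₂RingHom (ramify n hn) (p (MvPowerSeries.X 1)) := by
    apply Polynomial.ringHom_ext
    · intro a
      simpa using hC a
    · simp [planeEquiv_symm_X]
  exact DFunLike.congr_fun key P

theorem residue_eq_zero_iff (f : PowerSeries ℂ) :
    IsLocalRing.residue (PowerSeries ℂ) f = 0 ↔ constantCoeff f = 0 := by
  rw [IsLocalRing.residue_eq_zero_iff, IsLocalRing.mem_maximalIdeal, mem_nonunits_iff,
    PowerSeries.isUnit_iff_constantCoeff, isUnit_iff_ne_zero, not_not]

/-- A series is divisible by `x` if and only if it vanishes for `x = 0`. -/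
theorem C_X_dvd_iff {G : PowerSeries (PowerSeries ℂ)} :
    C X ∣ G ↔ PowerSeries.map constantCoeff G = 0 := by
  constructor
  · rintro ⟨H, rfl⟩
    simp
  · intro h
    have : ∀ k, ∃ g, PowerSeries.coeff k G = X * g := by
      intro k
      have := congrArg (PowerSeries.coeff k) h
      rw [PowerSeries.coeff_map, map_zero] at this
      exact PowerSeries.X_dvd_iff.2 this
    choose g hg using this
    refine ⟨PowerSeries.mk g, ?_⟩
    ext1 k
    rw [PowerSeries.coeff_C_mul, PowerSeries.coeff_mk, hg]

/-- Weierstrass polynomials: monic polynomials in `y` with coefficients in `ℂ⟦x⟧` whose reduction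
modulo `x` is a power of `y`. -/
structure IsWeierstrassPolynomial (Q : Polynomial (PowerSeries ℂ)) : Prop where
  monic : Q.Monic
  map_eq : Q.map constantCoeff = Polynomial.X ^ Q.natDegree

instance : IsAdicComplete (IsLocalRing.maximalIdeal (PowerSeries ℂ)) (PowerSeries ℂ) := by
  rw [PowerSeries.maximalIdeal_eq_span_X]; infer_instance

/-- The Weierstrass preparation theorem for a series in `x`, `y` which is not divisible by `x`. -/
theorem exists_weierstrass {G : PowerSeries (PowerSeries ℂ)} (hG : ¬ C X ∣ G) :
    ∃ (Q : Polynomial (PowerSeries ℂ)) (h : PowerSeries (PowerSeries ℂ)),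
      IsWeierstrassPolynomial Q ∧ IsUnit h ∧ G = Q * h := by
  have hG' : G.map (IsLocalRing.residue (PowerSeries ℂ)) ≠ 0 := by
    intro h0
    apply hG
    rw [C_X_dvd_iff]
    ext k
    have := congrArg (PowerSeries.coeff k) h0
    rw [PowerSeries.coeff_map, map_zero, residue_eq_zero_iff] at this
    rw [PowerSeries.coeff_map, map_zero, this]
  obtain ⟨Q, h, hQ⟩ := PowerSeries.exists_isWeierstrassFactorization hG'
  refine ⟨Q, h, ⟨hQ.isDistinguishedAt.monic, ?_⟩, hQ.isUnit, hQ.eq_mul⟩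
  ext k
  rw [Polynomial.coeff_map, Polynomial.coeff_X_pow]
  split_ifs with hk
  · rw [hk, hQ.isDistinguishedAt.monic.coeff_natDegree, map_one]
  · rcases lt_or_gt_of_ne hk with hk | hk
    · have := hQ.isDistinguishedAt.mem hk
      rwa [← residue_eq_zero_iff, IsLocalRing.residue_eq_zero_iff]
    · rw [Polynomial.coeff_eq_zero_of_natDegree_lt hk, map_zero]

/-- The roots of a Weierstrass polynomial have no constant term. -/
theorem IsWeierstrassPolynomial.constantCoeff_root {Q : Polynomial (PowerSeries ℂ)}
    (hQ : IsWeierstrassPolynomial Q) (h1 : Q.natDegree ≠ 0) {n : ℕ} (hn : n ≠ 0)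
    {ζ : PowerSeries ℂ} (h : Q.eval₂ (ramify n hn) ζ = 0) : constantCoeff ζ = 0 := by
  have h2 := congrArg constantCoeff h
  rw [Polynomial.hom_eval₂] at h2
  have h3 : (constantCoeff : PowerSeries ℂ →+* ℂ).comp (ramify n hn) = constantCoeff := by
    ext f
    simp
  rw [h3, ← Polynomial.eval_map, hQ.map_eq] at h2
  simpa [h1] using h2

/-- The Tschirnhausen transformation: a translation of the variable makes the subleading
coefficient vanish. -/
theorem exists_taylor_coeff_eq_zero (P : Polynomial (PowerSeries ℂ)) (hP : P.Monic)
    (h1 : P.natDegree ≠ 0) :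
    ∃ a : PowerSeries ℂ, (Polynomial.taylor a P).coeff (P.natDegree - 1) = 0 := by
  obtain ⟨m, hm⟩ := Nat.exists_eq_succ_of_ne_zero h1
  refine ⟨-(C ((m + 1 : ℂ)⁻¹) * P.coeff m), ?_⟩
  rw [hm, Nat.succ_sub_one, Polynomial.taylor_coeff]
  have hd : (Polynomial.hasseDeriv m P).natDegree ≤ 1 := by
    refine (Polynomial.natDegree_hasseDeriv_le P m).trans ?_
    omega
  have hm' : P.coeff (1 + m) = 1 := by
    have := hP.coeff_natDegree
    rwa [hm, Nat.succ_eq_one_add] at this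
  rw [Polynomial.eq_X_add_C_of_natDegree_le_one hd]
  simp only [Polynomial.hasseDeriv_coeff, hm', zero_add, Nat.choose_self]
  have hc : ((1 + m).choose m : PowerSeries ℂ) = C (m + 1 : ℂ) := by
    rw [add_comm, Nat.choose_succ_self_right]; simp
  have hne : (m + 1 : ℂ) ≠ 0 := by exact_mod_cast Nat.succ_ne_zero m
  have hcc : C (m + 1 : ℂ) * C ((m + 1 : ℂ)⁻¹) = 1 := by
    rw [← map_mul, mul_inv_cancel₀ hne, map_one]
  rw [hc]
  simp only [mul_one, Polynomial.eval_add, Polynomial.eval_mul, Polynomial.eval_C,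
    Polynomial.eval_X, Nat.cast_one, one_mul, mul_neg, ← mul_assoc, hcc]
  ring

theorem eval₂_taylor {S T : Type*} [CommRing S] [CommRing T] (f : S →+* T) (a : S) (x : T)
    (P : Polynomial S) : (Polynomial.taylor a P).eval₂ f x = P.eval₂ f (x + f a) := by
  rw [Polynomial.taylor_apply, Polynomial.eval₂_comp]
  simp

/-- The Newton polygon step: the scaling by the smallest slope `p / n` makes some coefficient other
than the leading one a unit. -/
theorem exists_scaling (P : Polynomial (PowerSeries ℂ)) (hP : P.Monic)
    (hsub : P.coeff (P.natDegree - 1) = 0) (h0 : P.coeff 0 ≠ 0) :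
    ∃ (n : ℕ) (hn : n ≠ 0) (p : ℕ) (P' : Polynomial (PowerSeries ℂ)), P'.Monic ∧
      P'.natDegree = P.natDegree ∧ P'.coeff (P.natDegree - 1) = 0 ∧
      (∃ j < P.natDegree, constantCoeff (P'.coeff j) ≠ 0) ∧
      P.map (ramify n hn) = P'.scaleRoots (X ^ p) := by
  classical
  set m := P.natDegree with hm
  have hm0 : m ≠ 0 := by
    intro h
    rw [h, Nat.zero_sub] at hsub
    exact h0 hsub
  obtain ⟨j₀, hj₀, hmin⟩ := Finset.exists_min_image
    ((Finset.range m).filter fun j => P.coeff j ≠ 0)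
    (fun j => ((P.coeff j).order.toNat : ℚ) / ((m - j : ℕ) : ℚ))
    ⟨0, by simp [h0, Nat.pos_of_ne_zero hm0]⟩
  simp only [Finset.mem_filter, Finset.mem_range] at hj₀ hmin
  obtain ⟨hj₀m, hj₀⟩ := hj₀
  set n := m - j₀ with hn
  have hn0 : n ≠ 0 := by omega
  set p := (P.coeff j₀).order.toNat with hp
  have hdvd : ∀ j, ∃ c, j < m → expand n hn0 (P.coeff j) = X ^ (p * (m - j)) * c := by
    intro j
    by_cases hj : j < m
    swap
    · exact ⟨0, fun h => absurd h hj⟩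
    by_cases hc : P.coeff j = 0
    · exact ⟨0, fun _ => by simp [hc]⟩
    have h1 := hmin j ⟨hj, hc⟩
    have hnq : (0 : ℚ) < (n : ℕ) := by exact_mod_cast Nat.pos_of_ne_zero hn0
    have hjq : (0 : ℚ) < ((m - j : ℕ) : ℚ) := by exact_mod_cast Nat.sub_pos_of_lt hj
    rw [div_le_div_iff₀ hnq hjq] at h1
    have h2 : p * (m - j) ≤ (P.coeff j).order.toNat * n := by exact_mod_cast h1
    obtain ⟨g, hg⟩ := PowerSeries.X_pow_order_dvd (φ := P.coeff j)
    refine ⟨X ^ ((P.coeff j).order.toNat * n - p * (m - j)) * expand n hn0 g, fun _ => ?_⟩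
    conv_lhs => rw [hg]
    rw [map_mul, map_pow, PowerSeries.expand_X, ← mul_assoc, ← pow_add, ← pow_mul,
      mul_comm n, Nat.add_sub_cancel' h2]
  choose c hc using hdvd
  set T : Polynomial (PowerSeries ℂ) := ∑ j ∈ Finset.range m, Polynomial.C (c j) * Polynomial.X ^ j
  have hT : ∀ j, T.coeff j = if j < m then c j else 0 := by
    intro j
    simp [T, Polynomial.finsetSum_coeff, Polynomial.coeff_C_mul, Polynomial.coeff_X_pow]
  have hTd : T.degree < m := by
    rw [Polynomial.degree_lt_iff_coeff_zero]
    intro j hj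
    rw [hT, if_neg (by omega)]
  have hmon : (Polynomial.X ^ m + T).Monic := Polynomial.monic_X_pow_add hTd
  have hdeg : (Polynomial.X ^ m + T).natDegree = m := by
    rw [Polynomial.natDegree_add_eq_left_of_degree_lt]
    · simp
    · simpa using hTd
  have hco : ∀ j < m, (Polynomial.X ^ m + T).coeff j = c j := by
    intro j hj
    rw [Polynomial.coeff_add, Polynomial.coeff_X_pow, if_neg hj.ne, hT, if_pos hj, zero_add]
  refine ⟨n, hn0, p, Polynomial.X ^ m + T, hmon, hdeg, ?_, ⟨j₀, hj₀m, ?_⟩, ?_⟩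
  · rw [hco _ (by omega)]
    have := hc (m - 1) (by omega)
    rw [hsub, map_zero] at this
    exact (mul_eq_zero.1 this.symm).resolve_left (pow_ne_zero _ PowerSeries.X_ne_zero)
  · rw [hco _ hj₀m]
    have h1 := congrArg (PowerSeries.coeff (n * p)) (hc j₀ hj₀m)
    rw [PowerSeries.coeff_expand_mul, ← hn, mul_comm p n] at h1
    have h2 : PowerSeries.coeff (n * p) (X ^ (n * p) * c j₀) = constantCoeff (c j₀) := by
      have := PowerSeries.coeff_X_pow_mul (c j₀) (n * p) 0
      rwa [zero_add, PowerSeries.coeff_zero_eq_constantCoeff] at this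
    rw [← h2, ← h1]
    exact PowerSeries.coeff_order hj₀
  · ext1 j
    rw [Polynomial.coeff_map, Polynomial.coeff_scaleRoots, hdeg]
    rcases lt_trichotomy j m with hj | rfl | hj
    · rw [hco j hj, ← pow_mul, mul_comm]
      exact hc j hj
    · have h1 : P.coeff P.natDegree = 1 := hP
      have h2 := hmon.coeff_natDegree
      rw [hdeg] at h2
      rw [h2]
      simp [hm, h1]
    · rw [Polynomial.coeff_eq_zero_of_natDegree_lt (by omega),
        Polynomial.coeff_eq_zero_of_natDegree_lt (by omega)]
      simp

theorem not_C_X_dvd_of_monic {P : Polynomial (PowerSeries ℂ)} (hP : P.Monic) :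
    ¬ C X ∣ (P : PowerSeries (PowerSeries ℂ)) := by
  rintro ⟨g, hg⟩
  have := congrArg (PowerSeries.coeff P.natDegree) hg
  rw [PowerSeries.coeff_C_mul, Polynomial.coeff_coe, hP.coeff_natDegree] at this
  exact PowerSeries.X_prime.not_isUnit (IsUnit.of_mul_eq_one _ this.symm)

/-- The factor of a monic polynomial which collects the roots reducing to zero. -/
theorem exists_weierstrass_of_monic {P : Polynomial (PowerSeries ℂ)} (hP : P.Monic)
    (h0 : constantCoeff (P.coeff 0) = 0)
    (hne : P.map constantCoeff ≠ Polynomial.X ^ P.natDegree) :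
    ∃ (Q : Polynomial (PowerSeries ℂ)) (h : PowerSeries (PowerSeries ℂ)),
      IsWeierstrassPolynomial Q ∧ Q.natDegree ≠ 0 ∧ Q.natDegree < P.natDegree ∧
      (P : PowerSeries (PowerSeries ℂ)) = Q * h := by
  obtain ⟨Q, h, hQ, hh, he⟩ := exists_weierstrass (not_C_X_dvd_of_monic hP)
  have hmap := congrArg (PowerSeries.map (constantCoeff (R := ℂ))) he
  rw [map_mul, ← Polynomial.polynomial_map_coe, ← Polynomial.polynomial_map_coe, hQ.map_eq] at hmap
  refine ⟨Q, h, hQ, ?_, ?_, he⟩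
  · intro hz
    rw [hz, pow_zero, Polynomial.coe_one, one_mul] at hmap
    have hu := hh.map (PowerSeries.map (constantCoeff (R := ℂ)))
    rw [← hmap, PowerSeries.isUnit_iff_constantCoeff,
      ← PowerSeries.coeff_zero_eq_constantCoeff_apply,
      Polynomial.coeff_coe, Polynomial.coeff_map, h0] at hu
    exact not_isUnit_zero hu
  · by_contra hlt
    apply hne
    ext k
    rw [Polynomial.coeff_X_pow, Polynomial.coeff_map]
    split_ifs with hk
    · rw [hk, hP.coeff_natDegree, map_one]
    · rcases lt_or_gt_of_ne hk with hk | hk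
      · have := congrArg (PowerSeries.coeff k) hmap
        rw [Polynomial.coeff_coe, Polynomial.coeff_map, Polynomial.coe_pow, Polynomial.coe_X,
          PowerSeries.coeff_X_pow_mul', if_neg (by omega)] at this
        exact this
      · rw [Polynomial.coeff_eq_zero_of_natDegree_lt hk, map_zero]

/-- The theorem of Newton and Puiseux for monic polynomials. -/
theorem newton_puiseux_of_monic (P : Polynomial (PowerSeries ℂ)) (hP : P.Monic)
    (h1 : P.natDegree ≠ 0) :
    ∃ (n : ℕ) (hn : n ≠ 0) (ζ : PowerSeries ℂ), P.eval₂ (ramify n hn) ζ = 0 := by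
  induction hm : P.natDegree using Nat.strong_induction_on generalizing P with
  | _ m ih =>
  subst hm
  obtain ⟨a, ha⟩ := exists_taylor_coeff_eq_zero P hP h1
  set P₁ := Polynomial.taylor a P with hP₁
  have hP₁m : P₁.Monic := by
    rw [hP₁, Polynomial.taylor_apply]; exact hP.comp_X_add_C a
  have hP₁d : P₁.natDegree = P.natDegree := Polynomial.natDegree_taylor _ _
  suffices ∃ (n : ℕ) (hn : n ≠ 0) (ζ : PowerSeries ℂ), P₁.eval₂ (ramify n hn) ζ = 0 by
    obtain ⟨n, hn, ζ, h⟩ := this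
    exact ⟨n, hn, _, by rwa [hP₁, eval₂_taylor] at h⟩
  by_cases h0 : P₁.coeff 0 = 0
  · exact ⟨1, one_ne_zero, 0, by rw [Polynomial.eval₂_at_zero, h0, map_zero]⟩
  rw [← hP₁d] at ha
  obtain ⟨n, hn, p, P₂, hP₂m, hP₂d, hP₂c, ⟨j, hj, hjc⟩, hscale⟩ := exists_scaling P₁ hP₁m ha h0
  suffices ∃ (n : ℕ) (hn : n ≠ 0) (ζ : PowerSeries ℂ), P₂.eval₂ (ramify n hn) ζ = 0 by
    obtain ⟨n', hn', ζ, h⟩ := this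
    have h2 := Polynomial.scaleRoots_eval₂_eq_zero (s := X ^ p) (ramify n' hn') h
    rw [← hscale, Polynomial.eval₂_map] at h2
    have hcomp : (ramify n' hn').comp (ramify n hn) = ramify (n' * n) (Nat.mul_ne_zero hn' hn) :=
      RingHom.ext fun f => (PowerSeries.expand_mul n' hn' n hn f).symm
    rw [hcomp] at h2
    exact ⟨_, _, _, h2⟩
  -- a root of the polynomial obtained by setting `x = 0`
  have hbm : (P₂.map constantCoeff).Monic := hP₂m.map _
  have hbd : (P₂.map constantCoeff).natDegree = P.natDegree := by
    rw [hP₂m.natDegree_map, hP₂d, hP₁d]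
  obtain ⟨r, hr⟩ := IsAlgClosed.exists_root (P₂.map constantCoeff) (by
    rw [Polynomial.degree_eq_natDegree hbm.ne_zero, hbd]
    exact_mod_cast h1)
  set P₃ := Polynomial.taylor (C r) P₂ with hP₃
  have hP₃m : P₃.Monic := by
    rw [hP₃, Polynomial.taylor_apply]; exact hP₂m.comp_X_add_C _
  have hP₃d : P₃.natDegree = P.natDegree := by
    rw [hP₃, Polynomial.natDegree_taylor, hP₂d, hP₁d]
  have hP₃map : P₃.map constantCoeff = Polynomial.taylor r (P₂.map constantCoeff) := by
    rw [hP₃, Polynomial.taylor_apply, Polynomial.taylor_apply, Polynomial.map_comp]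
    simp
  suffices ∃ (n : ℕ) (hn : n ≠ 0) (ζ : PowerSeries ℂ), P₃.eval₂ (ramify n hn) ζ = 0 by
    obtain ⟨n, hn, ζ, h⟩ := this
    exact ⟨n, hn, _, by rwa [hP₃, eval₂_taylor] at h⟩
  -- the degree drops: the reduction of `P₂` is not a power of `y - r`, since its subleading
  -- coefficient vanishes and its lower coefficients do not all vanish
  obtain ⟨Q, h, hQ, hQ0, hQlt, he⟩ := exists_weierstrass_of_monic hP₃m (by
      rw [← Polynomial.coeff_map, hP₃map, Polynomial.taylor_coeff_zero]
      exact hr) (by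
      intro hX
      rw [hP₃map, hP₃d] at hX
      have hX' : P₂.map constantCoeff = (Polynomial.X - Polynomial.C r) ^ P.natDegree := by
        have := congrArg (Polynomial.taylor (-r)) hX
        rw [Polynomial.taylor_taylor] at this
        simpa [Polynomial.taylor_apply, sub_eq_add_neg] using this
      have hr0 : r = 0 := by
        have := congrArg (fun q => Polynomial.coeff q (P.natDegree - 1)) hX'
        simp only [Polynomial.coeff_map, ← hP₁d, hP₂c, map_zero] at this
        rw [sub_eq_add_neg, ← map_neg Polynomial.C, Polynomial.coeff_X_add_C_pow,
          Nat.sub_sub_self (by omega), pow_one] at this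
        have h3 := mul_eq_zero.1 this.symm
        rcases h3 with h3 | h3
        · simpa using h3
        · exact absurd h3 (Nat.cast_ne_zero.2 (Nat.choose_pos (Nat.sub_le _ _)).ne')
      apply hjc
      rw [← Polynomial.coeff_map, hX', hr0]
      rw [sub_eq_add_neg, ← map_neg Polynomial.C, Polynomial.coeff_X_add_C_pow,
        neg_zero, zero_pow (by omega), zero_mul])
  obtain ⟨n, hn, ζ, hζ⟩ := ih Q.natDegree (by omega) Q hQ.monic hQ0 rfl
  obtain ⟨q, hq0, hq1, -⟩ := exists_arc (X ^ n) ζ (by simp [hn]) (hQ.constantCoeff_root hQ0 hn hζ)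
  refine ⟨n, hn, ζ, ?_⟩
  rw [← hq1, ← arc_planeEquiv_symm_coe q hn hq0, he, map_mul, map_mul,
    arc_planeEquiv_symm_coe q hn hq0, hq1, hζ, zero_mul]

/-! ### Factoriality of the ring of formal power series and norms -/

/-- The minimal polynomial of an integral element over an integrally closed domain, for a
homomorphism which is not declared as an algebra structure. -/
theorem exists_monic_dvd_of_isIntegralElem {A B : Type*} [CommRing A] [IsDomain A]
    [IsIntegrallyClosed A] [CommRing B] [IsDomain B] (f : A →+* B) (hf : Function.Injective f)
    (ζ : B) (hζ : f.IsIntegralElem ζ) :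
    ∃ M : Polynomial A, M.eval₂ f ζ = 0 ∧ ∀ P : Polynomial A, P.eval₂ f ζ = 0 → M ∣ P := by
  let _ := f.toAlgebra
  have : FaithfulSMul A B := (faithfulSMul_iff_algebraMap_injective A B).2 hf
  have : Module.IsTorsionFree A B := inferInstance
  exact ⟨minpoly A ζ, minpoly.aeval A ζ, fun P hP => minpoly.isIntegrallyClosed_dvd hζ hP⟩

instance : IsDomain FormalPlane := planeEquiv.toMulEquiv.isDomain _

instance : WfDvdMonoid FormalPlane := IsNoetherianRing.wfDvdMonoid

theorem ramify_injective (n : ℕ) (hn : n ≠ 0) : Function.Injective (ramify n hn) := by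
  intro f g h
  ext k
  have := congrArg (PowerSeries.coeff (n * k)) h
  simpa using this

theorem C_X_dvd_planeEquiv {g : FormalPlane} : C X ∣ planeEquiv g ↔ MvPowerSeries.X 0 ∣ g := by
  rw [← planeEquiv_X_zero]
  exact map_dvd_iff planeEquiv

theorem prime_X_zero : Prime (MvPowerSeries.X 0 : FormalPlane) := by
  refine ⟨fun h0 => ?_, ?_, fun a b hab => ?_⟩
  · have := congrArg planeEquiv h0
    rw [planeEquiv_X_zero, map_zero] at this
    exact PowerSeries.X_ne_zero (PowerSeries.C_injective (this.trans (map_zero C).symm))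
  · rw [MvPowerSeries.isUnit_iff_constantCoeff]; simp
  · rw [← C_X_dvd_planeEquiv, C_X_dvd_iff] at *
    rw [← C_X_dvd_planeEquiv, C_X_dvd_iff]
    rw [map_mul, map_mul] at hab
    exact mul_eq_zero.1 hab

/-- The theorem of Newton and Puiseux: a curve without common component with `x = 0` has a
parametrized branch. -/
theorem exists_arc_of_not_dvd {g : FormalPlane} (hg : ¬ IsUnit g)
    (hX : ¬ MvPowerSeries.X 0 ∣ g) :
    ∃ (n : ℕ) (p : FormalPlane →ₐ[ℂ] PowerSeries ℂ), n ≠ 0 ∧ p (MvPowerSeries.X 0) = X ^ n ∧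
      p g = 0 := by
  rw [← C_X_dvd_planeEquiv] at hX
  obtain ⟨Q, u, hQ, hu, he⟩ := exists_weierstrass hX
  have hQ0 : Q.natDegree ≠ 0 := by
    intro h0
    rw [hQ.monic.natDegree_eq_zero.1 h0, Polynomial.coe_one, one_mul] at he
    apply hg
    rw [← he] at hu
    simpa using hu.map planeEquiv.symm
  obtain ⟨n, hn, ζ, hζ⟩ := newton_puiseux_of_monic Q hQ.monic hQ0
  obtain ⟨p, hp0, hp1, -⟩ := exists_arc (X ^ n) ζ (by simp [hn]) (hQ.constantCoeff_root hQ0 hn hζ)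
  refine ⟨n, p, hn, hp0, ?_⟩
  have : g = planeEquiv.symm (Q * u) := by rw [← he, AlgEquiv.symm_apply_apply]
  rw [this, map_mul, map_mul, arc_planeEquiv_symm_coe p hn hp0, hp1, hζ, zero_mul]

/-- An irreducible series which vanishes on an arc divides all the series which vanish on it: their
Weierstrass polynomials are multiples of the minimal polynomial of `y (t)` over `ℂ⟦x⟧`. -/
theorem dvd_of_arc {g h : FormalPlane} (hg : Irreducible g) {p : FormalPlane →ₐ[ℂ] PowerSeries ℂ}
    {n : ℕ} (hn : n ≠ 0) (hp : p (MvPowerSeries.X 0) = X ^ n) (hpg : p g = 0) (hph : p h = 0) :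
    g ∣ h := by
  have weier : ∀ f : FormalPlane, ¬ MvPowerSeries.X 0 ∣ f → p f = 0 →
      ∃ (Q : Polynomial (PowerSeries ℂ)) (u : PowerSeries (PowerSeries ℂ)),
        Q.Monic ∧ IsUnit u ∧ planeEquiv f = Q * u ∧
          Q.eval₂ (ramify n hn) (p (MvPowerSeries.X 1)) = 0 := by
    intro f hX hf
    rw [← C_X_dvd_planeEquiv] at hX
    obtain ⟨Q, u, hQ, hu, he⟩ := exists_weierstrass hX
    refine ⟨Q, u, hQ.monic, hu, he, ?_⟩
    have h1 : p (planeEquiv.symm (Q * u)) = 0 := by rw [← he, AlgEquiv.symm_apply_apply, hf]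
    rw [map_mul, map_mul, arc_planeEquiv_symm_coe p hn hp] at h1
    exact (mul_eq_zero.1 h1).resolve_right ((hu.map planeEquiv.symm).map p).ne_zero
  have hXg : ¬ MvPowerSeries.X 0 ∣ g := by
    rintro ⟨c, rfl⟩
    rw [map_mul, hp] at hpg
    have hpc := (mul_eq_zero.1 hpg).resolve_left (pow_ne_zero _ PowerSeries.X_ne_zero)
    have hc := (hg.isUnit_or_isUnit rfl).resolve_left prime_X_zero.not_isUnit
    exact (hc.map p).ne_zero hpc
  rcases eq_or_ne h 0 with rfl | h0
  · exact dvd_zero g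
  obtain ⟨a, h', hX', rfl⟩ := WfDvdMonoid.max_power_factor h0 prime_X_zero.irreducible
  have hph' : p h' = 0 := by
    rw [map_mul, map_pow, hp] at hph
    exact (mul_eq_zero.1 hph).resolve_left (pow_ne_zero _ (pow_ne_zero _ PowerSeries.X_ne_zero))
  refine Dvd.dvd.mul_left ?_ _
  obtain ⟨Q, u, hQ, hu, he, hQ0⟩ := weier g hXg hpg
  obtain ⟨Q', u', hQ', hu', he', hQ0'⟩ := weier h' hX' hph'
  obtain ⟨M, hM, hMdvd⟩ := exists_monic_dvd_of_isIntegralElem (ramify n hn) (ramify_injective n hn)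
    (p (MvPowerSeries.X 1)) ⟨Q, hQ, hQ0⟩
  obtain ⟨S, rfl⟩ := hMdvd Q hQ0
  obtain ⟨S', rfl⟩ := hMdvd Q' hQ0'
  have hirr : Irreducible (planeEquiv g) := (MulEquiv.irreducible_iff planeEquiv).2 hg
  have hMu : ¬ IsUnit (M : PowerSeries (PowerSeries ℂ)) := by
    intro hu
    have := (hu.map planeEquiv.symm).map p
    rw [arc_planeEquiv_symm_coe p hn hp, hM] at this
    exact not_isUnit_zero this
  rw [Polynomial.coe_mul, mul_assoc] at he he'
  have hSu := (hirr.isUnit_or_isUnit he).resolve_left hMu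
  rw [← map_dvd_iff planeEquiv, he, he']
  exact (hSu.mul_right_dvd.2 dvd_rfl).trans (dvd_mul_right _ _)

/-- An irreducible series other than `x` is prime because it generates the kernel of an arc. -/
instance : UniqueFactorizationMonoid FormalPlane where
  wf := (inferInstance : WfDvdMonoid FormalPlane).wf
  irreducible_iff_prime := by
    intro g
    refine ⟨fun hg => ?_, Prime.irreducible⟩
    by_cases hX : MvPowerSeries.X 0 ∣ g
    · exact (prime_X_zero.irreducible.associated_of_dvd hg hX).prime prime_X_zero
    · obtain ⟨n, p, hn, hp, hpg⟩ := exists_arc_of_not_dvd hg.not_isUnit hX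
      refine ⟨hg.ne_zero, hg.not_isUnit, fun a b hab => ?_⟩
      obtain ⟨c, hc⟩ := hab
      have := congrArg p hc
      rw [map_mul, map_mul, hpg, zero_mul, mul_eq_zero] at this
      exact this.imp (dvd_of_arc hg hn hp hpg) (dvd_of_arc hg hn hp hpg)

/-- The series in `t ^ n` are those which are invariant under `t ↦ ω t`. -/
theorem mem_range_ramify {n : ℕ} (hn : n ≠ 0) {ω : ℂ} (hω : IsPrimitiveRoot ω n)
    {f : PowerSeries ℂ} (hf : PowerSeries.rescale ω f = f) : ∃ g, ramify n hn g = f := by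
  refine ⟨PowerSeries.mk fun k => PowerSeries.coeff (n * k) f, ?_⟩
  ext k
  change PowerSeries.coeff k (expand n hn _) = _
  by_cases hk : n ∣ k
  · obtain ⟨l, rfl⟩ := hk
    rw [PowerSeries.coeff_expand_mul, PowerSeries.coeff_mk]
  · rw [PowerSeries.coeff_expand_of_not_dvd _ _ _ hk]
    have := congrArg (PowerSeries.coeff k) hf
    rw [PowerSeries.coeff_rescale] at this
    by_contra h0
    exact hk ((hω.pow_eq_one_iff_dvd k).1 (mul_right_cancel₀ (Ne.symm h0) (by rw [this, one_mul])))

/-- The norm of `y - ζ (t)` over `ℂ⟦t ^ n⟧`: the product of its conjugates has coefficients which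
are series in `t ^ n`. -/
theorem exists_norm {n : ℕ} (hn : n ≠ 0) {ω : ℂ} (hω : IsPrimitiveRoot ω n) (ζ : PowerSeries ℂ) :
    ∃ N : Polynomial (PowerSeries ℂ), N.Monic ∧ N.map (ramify n hn) =
      ∏ j ∈ Finset.range n, (Polynomial.X - Polynomial.C (PowerSeries.rescale (ω ^ j) ζ)) := by
  set F : ℕ → Polynomial (PowerSeries ℂ) := fun j =>
    Polynomial.X - Polynomial.C (PowerSeries.rescale (ω ^ j) ζ) with hF
  have hFm : ∀ j, (F j).Monic := fun j => Polynomial.monic_X_sub_C _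
  have hshift : ∏ j ∈ Finset.range n, F (j + 1) = ∏ j ∈ Finset.range n, F j := by
    have h1 := Finset.prod_range_succ F n
    rw [Finset.prod_range_succ'] at h1
    have h2 : F n = F 0 := by simp [hF, hω.pow_eq_one]
    rw [h2] at h1
    exact mul_right_cancel₀ (hFm 0).ne_zero h1
  have hmap : (∏ j ∈ Finset.range n, F j).map (PowerSeries.rescale ω) =
      ∏ j ∈ Finset.range n, F j := by
    refine Eq.trans ?_ hshift
    rw [Polynomial.map_prod]
    refine Finset.prod_congr rfl fun j _ => ?_
    rw [hF]
    simp only [Polynomial.map_sub, Polynomial.map_X, Polynomial.map_C, PowerSeries.rescale_rescale,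
      pow_succ]
  have hmonic : (∏ j ∈ Finset.range n, F j).Monic :=
    Polynomial.monic_prod_of_monic _ _ fun j _ => hFm j
  have hl : (∏ j ∈ Finset.range n, F j) ∈ Polynomial.lifts (ramify n hn) := by
    rw [Polynomial.lifts_iff_coeff_lifts]
    intro k
    apply mem_range_ramify hn hω
    rw [← Polynomial.coeff_map, hmap]
  obtain ⟨N, hN, -, hNm⟩ := Polynomial.lifts_and_natDegree_eq_and_monic hl hmonic
  exact ⟨N, hNm, hN⟩

/-! ### Newton-Puiseux series -/

theorem coeff_puiseux (n : ℕ+) (ζ : PowerSeries ℂ) (k : ℕ) :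
    (puiseux n ζ).coeff ((k : ℚ) / (n : ℕ)) = PowerSeries.coeff k ζ := by
  have := HahnSeries.embDomain_coeff (f := exponentEmbedding n)
    (x := HahnSeries.toPowerSeries.symm ζ) (a := k)
  rw [HahnSeries.coeff_toPowerSeries_symm] at this
  exact this

theorem coeff_puiseux_of_forall_ne (n : ℕ+) (ζ : PowerSeries ℂ) {q : ℚ}
    (hq : ∀ k : ℕ, q ≠ (k : ℚ) / (n : ℕ)) : (puiseux n ζ).coeff q = 0 := by
  apply HahnSeries.embDomain_of_notMem_range
  rintro ⟨k, hk⟩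
  exact hq k hk.symm

theorem eq_puiseux_iff {n : ℕ+} {ζ : PowerSeries ℂ} {η : HahnSeries ℚ ℂ} :
    η = puiseux n ζ ↔ (∀ k : ℕ, η.coeff ((k : ℚ) / (n : ℕ)) = PowerSeries.coeff k ζ) ∧
      ∀ q : ℚ, (∀ k : ℕ, q ≠ (k : ℚ) / (n : ℕ)) → η.coeff q = 0 := by
  constructor
  · rintro rfl
    exact ⟨coeff_puiseux n ζ, fun q => coeff_puiseux_of_forall_ne n ζ⟩
  · rintro ⟨h1, h2⟩
    ext q
    by_cases hq : ∃ k : ℕ, q = (k : ℚ) / (n : ℕ)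
    · obtain ⟨k, rfl⟩ := hq
      rw [h1, coeff_puiseux]
    · push Not at hq
      rw [h2 q hq, coeff_puiseux_of_forall_ne n ζ hq]

theorem puiseux_sub (n : ℕ+) (ζ ζ' : PowerSeries ℂ) :
    puiseux n ζ - puiseux n ζ' = puiseux n (ζ - ζ') := by
  rw [eq_puiseux_iff]
  refine ⟨fun k => ?_, fun q hq => ?_⟩
  · rw [HahnSeries.coeff_sub, coeff_puiseux, coeff_puiseux, map_sub]
  · rw [HahnSeries.coeff_sub, coeff_puiseux_of_forall_ne n _ hq, coeff_puiseux_of_forall_ne n _ hq,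
      sub_zero]

theorem puiseux_zero (n : ℕ+) : puiseux n 0 = 0 := by
  have := puiseux_sub n 0 0
  rwa [sub_self, sub_self, eq_comm] at this

/-- `ζ (x ^ (1 / n))` may be rewritten with the denominator `n m`. -/
theorem puiseux_expand (n m : ℕ+) (ζ : PowerSeries ℂ) :
    puiseux (n * m) (expand m m.ne_zero ζ) = puiseux n ζ := by
  symm
  rw [eq_puiseux_iff]
  have hm : ((m : ℕ) : ℚ) ≠ 0 := by exact_mod_cast m.ne_zero
  have hn : ((n : ℕ) : ℚ) ≠ 0 := by exact_mod_cast n.ne_zero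
  refine ⟨fun k => ?_, fun q hq => ?_⟩
  · by_cases hk : (m : ℕ) ∣ k
    · obtain ⟨l, rfl⟩ := hk
      rw [PowerSeries.coeff_expand_mul, ← coeff_puiseux n]
      congr 1
      push_cast
      field_simp
    · rw [PowerSeries.coeff_expand_of_not_dvd _ _ _ hk]
      apply coeff_puiseux_of_forall_ne
      intro l hl
      apply hk
      refine ⟨l, ?_⟩
      push_cast at hl
      rw [div_eq_div_iff (by positivity) hn] at hl
      have h2 : (k : ℚ) = m * l := by
        apply mul_right_cancel₀ hn
        rw [hl]; ring
      exact_mod_cast h2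
  · apply coeff_puiseux_of_forall_ne
    intro l hl
    apply hq (m * l)
    rw [hl]
    push_cast
    field_simp

theorem order_eq_of_coeff {η : HahnSeries ℚ ℂ} {q : ℚ} (h : η.coeff q ≠ 0)
    (h' : ∀ r < q, η.coeff r = 0) : η.order = q := by
  have hne : η ≠ 0 := by rintro rfl; simp at h
  apply le_antisymm (HahnSeries.order_le_of_coeff_ne_zero h)
  by_contra hlt
  exact hne (HahnSeries.coeff_order_eq_zero.1 (h' _ (not_le.1 hlt)))

theorem orderX_of_ne_zero {η : HahnSeries ℚ ℂ} (h : η ≠ 0) :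
    orderX η = ENNReal.ofReal (η.order : ℝ) := by
  rw [orderX, if_neg h]

theorem orderX_zero : orderX 0 = ⊤ := by
  rw [orderX, if_pos rfl]

theorem orderX_eq_top {η : HahnSeries ℚ ℂ} : orderX η = ⊤ ↔ η = 0 := by
  refine ⟨fun h => ?_, fun h => h ▸ orderX_zero⟩
  by_contra h0
  rw [orderX_of_ne_zero h0] at h
  exact ENNReal.ofReal_ne_top h

theorem order_puiseux (n : ℕ+) {f : PowerSeries ℂ} (hf : f ≠ 0) :
    (puiseux n f).order = (f.order.toNat : ℚ) / (n : ℕ) := by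
  have hn : (0 : ℚ) < ((n : ℕ) : ℚ) := by exact_mod_cast n.pos
  apply order_eq_of_coeff
  · rw [coeff_puiseux]
    exact PowerSeries.coeff_order hf
  · intro r hr
    by_cases hq : ∃ k : ℕ, r = (k : ℚ) / (n : ℕ)
    · obtain ⟨k, rfl⟩ := hq
      rw [coeff_puiseux]
      rw [div_lt_div_iff_of_pos_right hn] at hr
      exact PowerSeries.coeff_of_lt_order_toNat _ (by exact_mod_cast hr)
    · push Not at hq
      exact coeff_puiseux_of_forall_ne n f hq

theorem puiseux_eq_zero {n : ℕ+} {f : PowerSeries ℂ} : puiseux n f = 0 ↔ f = 0 := by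
  refine ⟨fun h => ?_, fun h => h ▸ puiseux_zero n⟩
  ext k
  rw [← coeff_puiseux n, h]
  simp

theorem puiseux_injective (n : ℕ+) : Function.Injective (puiseux n) := by
  intro f g h
  rw [← sub_eq_zero, puiseux_sub, puiseux_eq_zero] at h
  exact sub_eq_zero.1 h

/-- Both sides are infinite when `f = 0`. -/
theorem orderX_puiseux (n : ℕ+) (f : PowerSeries ℂ) :
    orderX (puiseux n f) = (f.order : ℝ≥0∞) / (n : ℕ) := by
  rcases eq_or_ne f 0 with rfl | hf
  · rw [puiseux_zero, orderX_zero, PowerSeries.order_zero]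
    simp [ENNReal.top_div]
  · rw [orderX_of_ne_zero (by rwa [Ne, puiseux_eq_zero]), order_puiseux n hf,
      ← PowerSeries.coe_toNat_order hf]
    have hn : (0 : ℝ) < ((n : ℕ) : ℝ) := by exact_mod_cast n.pos
    push_cast
    rw [ENNReal.ofReal_div_of_pos hn]
    simp

theorem orderX_neg (η : HahnSeries ℚ ℂ) : orderX (-η) = orderX η := by
  rcases eq_or_ne η 0 with rfl | h
  · simp
  · rw [orderX_of_ne_zero h, orderX_of_ne_zero (neg_ne_zero.2 h), HahnSeries.order_neg]

theorem min_le_orderX_add (η η' : HahnSeries ℚ ℂ) :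
    min (orderX η) (orderX η') ≤ orderX (η + η') := by
  rcases eq_or_ne η 0 with rfl | h
  · simp
  rcases eq_or_ne η' 0 with rfl | h'
  · simp
  rcases eq_or_ne (η + η') 0 with h0 | h0
  · simp [h0, orderX_zero]
  rw [orderX_of_ne_zero h, orderX_of_ne_zero h', orderX_of_ne_zero h0,
    ← ENNReal.ofReal_min]
  apply ENNReal.ofReal_le_ofReal
  exact_mod_cast HahnSeries.min_order_le_order_add h0

theorem orderX_sub_comm (η η' : HahnSeries ℚ ℂ) : orderX (η - η') = orderX (η' - η) := by
  rw [← orderX_neg, neg_sub]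

theorem min_le_orderX_sub (ξ₁ ξ₂ ξ₃ : HahnSeries ℚ ℂ) :
    min (orderX (ξ₁ - ξ₂)) (orderX (ξ₂ - ξ₃)) ≤ orderX (ξ₁ - ξ₃) := by
  simpa using min_le_orderX_add (ξ₁ - ξ₂) (ξ₂ - ξ₃)

/-- The `k`-th power of the monodromy automorphism `x ^ q ↦ exp (2 π i q) x ^ q`. -/
def twist (k : ℤ) (η : HahnSeries ℚ ℂ) : HahnSeries ℚ ℂ where
  coeff q := Complex.exp (2 * Real.pi * Complex.I * (k * q)) * η.coeff q
  isPWO_support' := η.isPWO_support.mono fun q hq => by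
    rw [Function.mem_support] at hq
    exact right_ne_zero_of_mul hq

theorem coeff_twist (k : ℤ) (η : HahnSeries ℚ ℂ) (q : ℚ) :
    (twist k η).coeff q = Complex.exp (2 * Real.pi * Complex.I * (k * q)) * η.coeff q := rfl

theorem twist_sub (k : ℤ) (η η' : HahnSeries ℚ ℂ) :
    twist k (η - η') = twist k η - twist k η' := by
  ext q
  simp only [coeff_twist, HahnSeries.coeff_sub, mul_sub]

theorem twist_twist (k l : ℤ) (η : HahnSeries ℚ ℂ) : twist k (twist l η) = twist (k + l) η := by
  ext q
  simp only [coeff_twist, ← mul_assoc, ← Complex.exp_add]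
  congr 2
  push_cast
  ring

theorem twist_zero (η : HahnSeries ℚ ℂ) : twist 0 η = η := by
  ext q
  simp [coeff_twist]

theorem orderX_twist (k : ℤ) (η : HahnSeries ℚ ℂ) : orderX (twist k η) = orderX η := by
  rcases eq_or_ne η 0 with rfl | h
  · congr 1
    ext q
    simp [coeff_twist]
  · have h1 : (twist k η).coeff η.order ≠ 0 := by
      rw [coeff_twist]
      exact mul_ne_zero (Complex.exp_ne_zero _) (mt HahnSeries.coeff_order_eq_zero.1 h)
    have h2 : twist k η ≠ 0 := by
      intro h0
      rw [h0] at h1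
      simp at h1
    rw [orderX_of_ne_zero h2, orderX_of_ne_zero h]
    congr 2
    apply order_eq_of_coeff h1
    intro r hr
    rw [coeff_twist, HahnSeries.coeff_eq_zero_of_lt_order hr, mul_zero]

theorem twist_puiseux (k : ℤ) (n : ℕ+) (ζ : PowerSeries ℂ) :
    twist k (puiseux n ζ) =
      puiseux n
        (PowerSeries.rescale (Complex.exp (2 * Real.pi * Complex.I * (k / (n : ℕ)))) ζ) := by
  rw [eq_puiseux_iff]
  refine ⟨fun l => ?_, fun q hq => ?_⟩
  · rw [coeff_twist, coeff_puiseux, PowerSeries.coeff_rescale, ← Complex.exp_nat_mul]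
    congr 2
    push_cast
    ring
  · rw [coeff_twist, coeff_puiseux_of_forall_ne n ζ hq, mul_zero]

/-! ### Newton-Puiseux roots and parametrizations -/

section Roots

variable {R : Type*} [CommRing R] [Algebra ℂ R]

/-- The Newton-Puiseux roots of `A` are the series `y (x ^ (1 / n))` given by the parametrizations
`x = t ^ n`, `y = y (t)` of `A`. -/
theorem mem_roots_iff {φ : Coordinates R} {A : Ideal R} {η : HahnSeries ℚ ℂ} :
    η ∈ roots φ A ↔ ∃ (n : ℕ+) (p : R →ₐ[ℂ] PowerSeries ℂ),
      p (φ (MvPowerSeries.X 0)) = X ^ (n : ℕ) ∧ A ≤ RingHom.ker p ∧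
        η = puiseux n (p (φ (MvPowerSeries.X 1))) := by
  constructor
  · rintro ⟨n, ζ, hζ, rfl, h⟩
    obtain ⟨p, hp0, hp1, hp⟩ := exists_arc (X ^ (n : ℕ)) ζ (by simp) hζ
    refine ⟨n, p.comp (φ.symm : R →ₐ[ℂ] FormalPlane), by simp [hp0], fun g hg => ?_, by simp [hp1]⟩
    rw [RingHom.mem_ker]
    simpa [hp] using h g hg
  · rintro ⟨n, p, hp0, hA, rfl⟩
    have hc := constantCoeff_algHom_X (p.comp (φ : FormalPlane →ₐ[ℂ] R)) 1
    have hc' : constantCoeff (p (φ (MvPowerSeries.X 1))) = 0 := hc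
    refine ⟨n, p (φ (MvPowerSeries.X 1)), hc', rfl, fun g hg => ?_⟩
    obtain ⟨q, hq0, hq1, hq⟩ := exists_arc (X ^ (n : ℕ)) (p (φ (MvPowerSeries.X 1))) (by simp) hc'
    have : q = p.comp (φ : FormalPlane →ₐ[ℂ] R) := by
      apply arc_ext
      intro i
      fin_cases i
      · simpa [hq0] using hp0.symm
      · simpa using hq1
    rw [← hq, this]
    simpa using hA hg

/-- Two roots have a common denominator. -/
theorem exists_common_denominator {φ : Coordinates R} {A B : Ideal R} {ξ ξ' : HahnSeries ℚ ℂ}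
    (h : ξ ∈ roots φ A) (h' : ξ' ∈ roots φ B) :
    ∃ (n : ℕ+) (p p' : R →ₐ[ℂ] PowerSeries ℂ), p (φ (MvPowerSeries.X 0)) = X ^ (n : ℕ) ∧
      p' (φ (MvPowerSeries.X 0)) = X ^ (n : ℕ) ∧ A ≤ RingHom.ker p ∧ B ≤ RingHom.ker p' ∧
      ξ = puiseux n (p (φ (MvPowerSeries.X 1))) ∧ ξ' = puiseux n (p' (φ (MvPowerSeries.X 1))) := by
  obtain ⟨n, p, hp, hA, rfl⟩ := mem_roots_iff.1 h
  obtain ⟨m, q, hq, hB, rfl⟩ := mem_roots_iff.1 h'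
  refine ⟨n * m, (expand m m.ne_zero).comp p, (expand n n.ne_zero).comp q, ?_, ?_, ?_, ?_, ?_, ?_⟩
  · rw [AlgHom.comp_apply, hp, map_pow, PowerSeries.expand_X, ← pow_mul, PNat.mul_coe, mul_comm]
  · rw [AlgHom.comp_apply, hq, map_pow, PowerSeries.expand_X, ← pow_mul, PNat.mul_coe]
  · intro g hg
    rw [RingHom.mem_ker, AlgHom.comp_apply, RingHom.mem_ker.1 (hA hg), map_zero]
  · intro g hg
    rw [RingHom.mem_ker, AlgHom.comp_apply, RingHom.mem_ker.1 (hB hg), map_zero]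
  · rw [AlgHom.comp_apply, puiseux_expand]
  · rw [AlgHom.comp_apply, mul_comm, puiseux_expand]

theorem twist_mem_roots {φ : Coordinates R} {A : Ideal R} {ξ : HahnSeries ℚ ℂ}
    (h : ξ ∈ roots φ A) (k : ℤ) : twist k ξ ∈ roots φ A := by
  obtain ⟨n, p, hp, hA, rfl⟩ := mem_roots_iff.1 h
  set ω := Complex.exp (2 * Real.pi * Complex.I * (k / (n : ℕ))) with hω
  have hr : ∀ f, PowerSeries.rescaleAlgHom ω f = PowerSeries.rescale ω f := fun f => by
    rw [← PowerSeries.coe_rescaleAlgHom]; rfl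
  have hω1 : ω ^ (n : ℕ) = 1 := by
    rw [hω, ← Complex.exp_nat_mul]
    have hn : ((n : ℕ) : ℂ) ≠ 0 := by exact_mod_cast n.ne_zero
    rw [Complex.exp_eq_one_iff]
    exact ⟨k, by field_simp⟩
  refine mem_roots_iff.2 ⟨n, (PowerSeries.rescaleAlgHom ω).comp p, ?_, ?_, ?_⟩
  · rw [AlgHom.comp_apply, hp, hr, map_pow, PowerSeries.rescale_X, mul_pow, ← map_pow, hω1, map_one,
      one_mul]
  · intro g hg
    rw [RingHom.mem_ker, AlgHom.comp_apply, RingHom.mem_ker.1 (hA hg), map_zero]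
  · rw [AlgHom.comp_apply, hr, twist_puiseux]

theorem arc_symm_coe (φ : Coordinates R) (p : R →ₐ[ℂ] PowerSeries ℂ) {n : ℕ} (hn : n ≠ 0)
    (hp : p (φ (MvPowerSeries.X 0)) = X ^ n) (P : Polynomial (PowerSeries ℂ)) :
    p (φ (planeEquiv.symm (P : PowerSeries (PowerSeries ℂ)))) =
      P.eval₂ (ramify n hn) (p (φ (MvPowerSeries.X 1))) :=
  arc_planeEquiv_symm_coe (p.comp (φ : FormalPlane →ₐ[ℂ] R)) hn hp P

/-- The ideal of a branch is the kernel of each of its parametrizations. -/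
theorem ker_eq_of_isBranch (φ : Coordinates R) {A : Ideal R} (hA : IsBranch A) {n : ℕ}
    (hn : n ≠ 0) {p : R →ₐ[ℂ] PowerSeries ℂ} (hp : p (φ (MvPowerSeries.X 0)) = X ^ n)
    (h : A ≤ RingHom.ker p) : RingHom.ker p = A := by
  refine le_antisymm (fun f hf => ?_) h
  obtain ⟨g, hg, rfl⟩ := hA
  rw [Ideal.mem_span_singleton, ← map_dvd_iff φ.symm]
  have hg' : Irreducible (φ.symm g) := (MulEquiv.irreducible_iff φ.symm).2 hg
  refine dvd_of_arc hg' hn (p := p.comp (φ : FormalPlane →ₐ[ℂ] R)) hp ?_ ?_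
  · have := h (Ideal.mem_span_singleton_self g)
    simpa using this
  · simpa using hf

/-- The norm of `y - ζ (t)` is a function on the surface which vanishes on the arc `y = ζ (t)` and,
among all arcs, only on those which are conjugate to it. -/
theorem exists_norm_element (φ : Coordinates R) {n : ℕ} (hn : n ≠ 0) (p : R →ₐ[ℂ] PowerSeries ℂ)
    (hp : p (φ (MvPowerSeries.X 0)) = X ^ n) {ω : ℂ} (hω : IsPrimitiveRoot ω n) :
    ∃ g : R, g ≠ 0 ∧ p g = 0 ∧ ∀ (m : ℕ) (hm : m ≠ 0) (q : R →ₐ[ℂ] PowerSeries ℂ),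
      q (φ (MvPowerSeries.X 0)) = X ^ m → q g = 0 →
      ∃ j : ℕ, expand n hn (q (φ (MvPowerSeries.X 1))) =
        expand m hm (PowerSeries.rescale (ω ^ j) (p (φ (MvPowerSeries.X 1)))) := by
  obtain ⟨N, hN, hmap⟩ := exists_norm hn hω (p (φ (MvPowerSeries.X 1)))
  refine ⟨φ (planeEquiv.symm N), ?_, ?_, ?_⟩
  · intro h0
    have h1 : (N : PowerSeries (PowerSeries ℂ)) = 0 := by simpa using h0
    exact hN.ne_zero (Polynomial.coe_eq_zero_iff.1 h1)
  · rw [arc_symm_coe φ p hn hp, ← Polynomial.eval_map, hmap, Polynomial.eval_prod]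
    exact Finset.prod_eq_zero (Finset.mem_range.2 (Nat.pos_of_ne_zero hn)) (by simp)
  · intro m hm q hq h0
    rw [arc_symm_coe φ q hm hq] at h0
    have h1 := congrArg (ramify n hn) h0
    have hcomm : (ramify n hn).comp (ramify m hm) = (ramify m hm).comp (ramify n hn) := by
      ext1 f
      have h1 := PowerSeries.expand_mul n hn m hm f
      have h2 := PowerSeries.expand_mul m hm n hn f
      simp only [mul_comm m n] at h2
      exact h1.symm.trans h2
    rw [Polynomial.hom_eval₂, hcomm, ← Polynomial.eval₂_map, hmap, map_zero,
      Polynomial.eval₂_finsetProd, Finset.prod_eq_zero_iff] at h1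
    obtain ⟨j, -, hj⟩ := h1
    refine ⟨j, ?_⟩
    simpa [sub_eq_zero] using hj

/-- The functions which vanish on an arc form the ideal of a branch. -/
theorem isBranch_ker (φ : Coordinates R) {n : ℕ} (hn : n ≠ 0) (p : R →ₐ[ℂ] PowerSeries ℂ)
    (hp : p (φ (MvPowerSeries.X 0)) = X ^ n) : IsBranch (RingHom.ker p) := by
  have : IsDomain R := φ.symm.toMulEquiv.isDomain _
  have : UniqueFactorizationMonoid R := φ.toMulEquiv.uniqueFactorizationMonoid inferInstance
  obtain ⟨g, hg0, hpg, -⟩ := exists_norm_element φ hn p hp (Complex.isPrimitiveRoot_exp n hn)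
  have hprime : (RingHom.ker p).IsPrime := RingHom.ker_isPrime _
  obtain ⟨h, hh, hmem⟩ : ∃ h : R, Irreducible h ∧ p h = 0 := by
    by_contra hcon
    push Not at hcon
    refine absurd hpg ?_
    induction g using WfDvdMonoid.induction_on_irreducible with
    | zero => exact absurd rfl hg0
    | unit u hu => exact (hu.map p).ne_zero
    | mul a i ha hi ih =>
      rw [map_mul]
      exact mul_ne_zero (hcon i hi) fun h0 => ih ha h0 h0
  have hB : IsBranch (Ideal.span {h}) := ⟨h, hh, rfl⟩
  rw [ker_eq_of_isBranch φ hB hn hp ((Ideal.span_singleton_le_iff_mem _).2 hmem)]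
  exact hB

/-- The roots of a branch form a single orbit of the monodromy. -/
theorem exists_eq_twist {φ : Coordinates R} {A : Ideal R} (hA : IsBranch A) {ξ ξ' : HahnSeries ℚ ℂ}
    (h : ξ ∈ roots φ A) (h' : ξ' ∈ roots φ A) : ∃ k : ℤ, ξ' = twist k ξ := by
  obtain ⟨n, p, hp, hpA, rfl⟩ := mem_roots_iff.1 h
  obtain ⟨m, q, hq, hqA, rfl⟩ := mem_roots_iff.1 h'
  obtain ⟨g, -, hpg, hg⟩ := exists_norm_element φ n.ne_zero p hp
    (Complex.isPrimitiveRoot_exp n n.ne_zero)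
  have hgA : g ∈ A := by
    rw [← ker_eq_of_isBranch φ hA n.ne_zero hp hpA]
    exact hpg
  obtain ⟨j, hj⟩ := hg m m.ne_zero q hq (hqA hgA)
  refine ⟨j, ?_⟩
  rw [twist_puiseux, ← puiseux_expand m n, hj, mul_comm m n, puiseux_expand]
  congr 3
  rw [← Complex.exp_nat_mul]
  congr 1
  push_cast
  ring

theorem firstAxis_not_le_ker {φ : Coordinates R} {n : ℕ} {p : R →ₐ[ℂ] PowerSeries ℂ}
    (hp : p (φ (MvPowerSeries.X 0)) = X ^ n) : ¬ firstAxis φ ≤ RingHom.ker p := by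
  intro h
  have := h (Ideal.mem_span_singleton_self _)
  rw [RingHom.mem_ker, hp] at this
  exact pow_ne_zero _ PowerSeries.X_ne_zero this

theorem roots_nonempty {φ : Coordinates R} {A : Ideal R} (hA : IsBranch A) (hL : A ≠ firstAxis φ) :
    (roots φ A).Nonempty := by
  obtain ⟨g, hg, rfl⟩ := hA
  have hg' : Irreducible (φ.symm g) := (MulEquiv.irreducible_iff φ.symm).2 hg
  obtain ⟨n, p, hn, hp, hpg⟩ := exists_arc_of_not_dvd hg'.not_isUnit (fun hX => hL (by
    have : IsDomain R := φ.symm.toMulEquiv.isDomain _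
    rw [firstAxis, Ideal.span_singleton_eq_span_singleton]
    have h1 := (prime_X_zero.irreducible.associated_of_dvd hg' hX).map φ
    simpa using h1.symm))
  refine ⟨_, mem_roots_iff.2 ⟨⟨n, Nat.pos_of_ne_zero hn⟩,
    p.comp (φ.symm : R →ₐ[ℂ] FormalPlane), by simpa using hp, ?_, rfl⟩⟩
  rw [Ideal.span_singleton_le_iff_mem]
  simpa using hpg

end Roots

/-! ### Independence of the coordinates -/

section Contacts

variable {R : Type*} [CommRing R] [Algebra ℂ R]

/-- The set of contacts of two branches: the orders of the differences of a root of `A` and a root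
of `B`. The value `∞` is included when there is a common root. -/
def contacts (φ : Coordinates R) (A B : Ideal R) : Set ℝ≥0∞ :=
  {s | ∃ ξ ∈ roots φ A, ∃ ξ' ∈ roots φ B, s = orderX (ξ - ξ')}

theorem mem_contacts_iff {φ : Coordinates R} {A B : Ideal R} {s : ℝ≥0∞} :
    s ∈ contacts φ A B ↔ ∃ (n : ℕ+) (p p' : R →ₐ[ℂ] PowerSeries ℂ),
      p (φ (MvPowerSeries.X 0)) = X ^ (n : ℕ) ∧ p' (φ (MvPowerSeries.X 0)) = X ^ (n : ℕ) ∧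
      A ≤ RingHom.ker p ∧ B ≤ RingHom.ker p' ∧
      s = ((p (φ (MvPowerSeries.X 1)) - p' (φ (MvPowerSeries.X 1))).order : ℝ≥0∞) / (n : ℕ) := by
  constructor
  · rintro ⟨ξ, hξ, ξ', hξ', rfl⟩
    obtain ⟨n, p, p', hp, hp', hA, hB, rfl, rfl⟩ := exists_common_denominator hξ hξ'
    exact ⟨n, p, p', hp, hp', hA, hB, by rw [puiseux_sub, orderX_puiseux]⟩
  · rintro ⟨n, p, p', hp, hp', hA, hB, rfl⟩
    exact ⟨_, mem_roots_iff.2 ⟨n, p, hp, hA, rfl⟩, _, mem_roots_iff.2 ⟨n, p', hp', hB, rfl⟩,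
      by rw [puiseux_sub, orderX_puiseux]⟩

/-- The contact of two arcs with the same `x`-coordinate may be measured on `y` or on all functions;
the latter does not involve the coordinates. -/
theorem pow_dvd_iff_of_coordinates (φ : Coordinates R) {p p' : R →ₐ[ℂ] PowerSeries ℂ}
    (h0 : p (φ (MvPowerSeries.X 0)) = p' (φ (MvPowerSeries.X 0))) {m : ℕ} :
    X ^ m ∣ p (φ (MvPowerSeries.X 1)) - p' (φ (MvPowerSeries.X 1)) ↔ ∀ f, X ^ m ∣ p f - p' f := by
  refine ⟨fun h f => ?_, fun h => h _⟩
  have := pow_dvd_arc_sub (p := p.comp (φ : FormalPlane →ₐ[ℂ] R))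
    (q := p'.comp (φ : FormalPlane →ₐ[ℂ] R)) (m := m) (by
      intro i
      fin_cases i
      · simp [h0]
      · simpa using h) (φ.symm f)
  simpa using this

/-- A formal change of parameter `σ` together with its inverse `τ`. -/
structure IsInverse (σ τ : PowerSeries ℂ →ₐ[ℂ] PowerSeries ℂ) : Prop where
  left : constantCoeff (σ X) = 0
  right : constantCoeff (τ X) = 0
  comp : σ (τ X) = X
  comp' : τ (σ X) = X

theorem IsInverse.symm {σ τ : PowerSeries ℂ →ₐ[ℂ] PowerSeries ℂ} (h : IsInverse σ τ) :
    IsInverse τ σ := ⟨h.right, h.left, h.comp', h.comp⟩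

theorem IsInverse.apply {σ τ : PowerSeries ℂ →ₐ[ℂ] PowerSeries ℂ} (h : IsInverse σ τ)
    (f : PowerSeries ℂ) : σ (τ f) = f := by
  have : σ.comp τ = AlgHom.id ℂ _ := endo_ext (by simp) (by simpa using h.comp)
  exact DFunLike.congr_fun this f

theorem IsInverse.coeff_one_mul {σ τ : PowerSeries ℂ →ₐ[ℂ] PowerSeries ℂ} (h : IsInverse σ τ) :
    PowerSeries.coeff 1 (σ X) * PowerSeries.coeff 1 (τ X) = 1 := by
  obtain ⟨s, hs⟩ := PowerSeries.X_dvd_iff.2 h.left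
  obtain ⟨t, ht⟩ := PowerSeries.X_dvd_iff.2 h.right
  have hX := h.comp
  rw [ht, map_mul, hs] at hX
  have h1 := congrArg (PowerSeries.coeff 1) hX
  have e : ∀ u : PowerSeries ℂ, PowerSeries.coeff 1 (X * u) = constantCoeff u := by
    intro u
    have := PowerSeries.coeff_succ_X_mul 0 u
    rwa [zero_add, PowerSeries.coeff_zero_eq_constantCoeff_apply] at this
  rw [mul_assoc, e, map_mul, constantCoeff_endo σ t h.left, PowerSeries.coeff_one_X] at h1
  rw [hs, ht, e, e, h1]

theorem exists_isInverse {α : PowerSeries ℂ} (h0 : constantCoeff α = 0)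
    (h1 : PowerSeries.coeff 1 α ≠ 0) :
    ∃ τ σ : PowerSeries ℂ →ₐ[ℂ] PowerSeries ℂ, τ X = α ∧ IsInverse σ τ := by
  have hu : IsUnit (PowerSeries.coeff 1 α) := h1.isUnit
  obtain ⟨τ, hτ, hτ'⟩ := exists_endo α h0
  obtain ⟨σ, hσ, hσ'⟩ := exists_endo (α.substInvOfIsUnit hu)
    (PowerSeries.constantCoeff_substInvOfIsUnit α hu)
  refine ⟨τ, σ, hτ, ⟨?_, ?_, ?_, ?_⟩⟩
  · rw [hσ, PowerSeries.constantCoeff_substInvOfIsUnit]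
  · rw [hτ, h0]
  · rw [hτ, hσ', PowerSeries.subst_substInvOfIsUnit_right α h0 hu]
  · rw [hσ, hτ', PowerSeries.subst_substInvOfIsUnit_left α h0 hu]

/-- Inversion preserves the congruences between changes of parameter. -/
theorem pow_dvd_inverse_sub {σ τ σ' τ' : PowerSeries ℂ →ₐ[ℂ] PowerSeries ℂ} (h : IsInverse σ τ)
    (h' : IsInverse σ' τ') {m : ℕ} (hτ : X ^ m ∣ τ X - τ' X) : X ^ m ∣ σ X - σ' X := by
  -- `σ'(τ) - id` is divisible by `t ^ m`, hence so is its composition with `σ`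
  have h1 : X ^ m ∣ σ' (τ X) - X := by
    have e : σ' (τ X) - X = σ' (τ X - τ' X) := by rw [map_sub, h'.comp]
    rw [e]
    obtain ⟨g, hg⟩ := hτ
    obtain ⟨s, hs⟩ := PowerSeries.X_dvd_iff.2 h'.left
    rw [hg, map_mul, map_pow, hs, mul_pow, mul_assoc]
    exact dvd_mul_right _ _
  obtain ⟨θ, hθ, -⟩ := exists_endo (σ' (τ X)) (by rw [constantCoeff_endo _ _ h'.left, h.right])
  have h2 := pow_dvd_endo_sub (p := θ) (q := AlgHom.id ℂ _) (by simp) (by simpa [hθ] using h1) (σ X)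
  have h3 : θ = σ'.comp τ := endo_ext (by
    rw [AlgHom.comp_apply, constantCoeff_endo _ _ h'.left, h.right]) (by simpa using hθ)
  rw [h3, AlgHom.comp_apply, h.comp', AlgHom.id_apply] at h2
  rw [← neg_sub, dvd_neg]
  exact h2

/-- Reparametrizing by `n`-th roots of the coordinate `e x` does not decrease the contact. -/
theorem pow_dvd_reparam {p p' : R →ₐ[ℂ] PowerSeries ℂ} {x e : R} {n m : ℕ} (hn : n ≠ 0)
    (hp : p x = X ^ n) (hp' : p' x = X ^ n) {σ τ σ' τ' : PowerSeries ℂ →ₐ[ℂ] PowerSeries ℂ}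
    (h : IsInverse σ τ) (h' : IsInverse σ' τ') (hτ : τ X ^ n = p (e * x))
    (hτ' : τ' X ^ n = p' (e * x))
    (h1 : PowerSeries.coeff 1 (τ X) = PowerSeries.coeff 1 (τ' X))
    (hcong : ∀ f, X ^ m ∣ p f - p' f) (f : R) : X ^ m ∣ σ (p f) - σ' (p' f) := by
  have key : X ^ m ∣ τ X - τ' X := by
    have aux : ∀ (τ σ : PowerSeries ℂ →ₐ[ℂ] PowerSeries ℂ) (p : R →ₐ[ℂ] PowerSeries ℂ),
        IsInverse σ τ → p x = X ^ n → τ X ^ n = p (e * x) →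
        ∃ ρ, τ X = X * ρ ∧ ρ ^ n = p e ∧ constantCoeff ρ = PowerSeries.coeff 1 (τ X) := by
      intro τ σ p h hp hτ
      obtain ⟨ρ, hρ⟩ := PowerSeries.X_dvd_iff.2 h.right
      refine ⟨ρ, hρ, ?_, ?_⟩
      · rw [hρ, map_mul, hp, mul_pow, mul_comm] at hτ
        exact mul_right_cancel₀ (pow_ne_zero n PowerSeries.X_ne_zero) hτ
      · rw [hρ]
        have := PowerSeries.coeff_succ_X_mul 0 ρ
        rw [zero_add, PowerSeries.coeff_zero_eq_constantCoeff_apply] at this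
        exact this.symm
    obtain ⟨ρ, hρ, hρe, hρ0⟩ := aux τ σ p h hp hτ
    obtain ⟨ρ', hρ', hρe', hρ0'⟩ := aux τ' σ' p' h' hp' hτ'
    have hne : constantCoeff ρ ≠ 0 := by
      rw [hρ0]
      exact right_ne_zero_of_mul_eq_one h.coeff_one_mul
    have := pow_dvd_sub_of_pow (m := m) (r := ρ) (s := ρ') hn (by rw [hρ0, hρ0', h1]) hne
      (by rw [hρe, hρe']; exact hcong e)
    rw [hρ, hρ', ← mul_sub]
    exact this.mul_left _
  have e1 : σ (p f) - σ' (p' f) = (σ (p f) - σ' (p f)) + σ' (p f - p' f) := by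
    rw [map_sub]; ring
  rw [e1]
  refine dvd_add (pow_dvd_endo_sub h'.left (pow_dvd_inverse_sub h h' key) _) ?_
  obtain ⟨g, hg⟩ := hcong f
  obtain ⟨s, hs⟩ := PowerSeries.X_dvd_iff.2 h'.left
  rw [hg, map_mul, map_pow, hs, mul_pow, mul_assoc]
  exact dvd_mul_right _ _

theorem order_eq_order_of_pow_dvd_iff {f g : PowerSeries ℂ} (h : ∀ m : ℕ, X ^ m ∣ f ↔ X ^ m ∣ g) :
    f.order = g.order := by
  rw [PowerSeries.order_eq_emultiplicity_X, PowerSeries.order_eq_emultiplicity_X]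
  exact emultiplicity_eq_emultiplicity_iff.2 h

theorem contacts_subset_of_firstAxis_eq {φ φ' : Coordinates R}
    (hφ : firstAxis φ = firstAxis φ') (A B : Ideal R) : contacts φ A B ⊆ contacts φ' A B := by
  have : IsDomain R := φ.symm.toMulEquiv.isDomain _
  intro s hs
  obtain ⟨n, p, p', hp, hp', hA, hB, rfl⟩ := mem_contacts_iff.1 hs
  have hn := n.ne_zero
  set x := φ (MvPowerSeries.X 0) with hx
  set x' := φ' (MvPowerSeries.X 0) with hx'
  obtain ⟨e, he⟩ := Ideal.span_singleton_eq_span_singleton.1 hφ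
  replace he : (e : R) * x = x' := by rw [mul_comm]; exact he
  -- arcs are local, so the unit `e` has the same value at the origin of both
  have hconst : constantCoeff (p e) = constantCoeff (p' e) := by
    have h1 := pow_dvd_arc_sub (p := p.comp (φ : FormalPlane →ₐ[ℂ] R))
      (q := p'.comp (φ : FormalPlane →ₐ[ℂ] R)) (m := 1) (fun i => by
        rw [pow_one, PowerSeries.X_dvd_iff, map_sub, constantCoeff_algHom_X,
          constantCoeff_algHom_X, sub_zero]) (φ.symm e)
    rw [pow_one, PowerSeries.X_dvd_iff, map_sub, sub_eq_zero] at h1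
    simpa using h1
  obtain ⟨c, hc⟩ := IsAlgClosed.exists_pow_nat_eq (constantCoeff (p e)) n.pos
  have hc0 : c ≠ 0 := by
    rintro rfl
    rw [zero_pow hn] at hc
    exact (PowerSeries.isUnit_iff_constantCoeff.1 (e.isUnit.map p)).ne_zero hc.symm
  have reparam : ∀ q : R →ₐ[ℂ] PowerSeries ℂ, q x = X ^ (n : ℕ) →
      c ^ (n : ℕ) = constantCoeff (q e) →
      ∃ τ σ : PowerSeries ℂ →ₐ[ℂ] PowerSeries ℂ, IsInverse σ τ ∧ PowerSeries.coeff 1 (τ X) = c ∧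
        τ X ^ (n : ℕ) = q (e * x) ∧ σ (q x') = X ^ (n : ℕ) ∧
          σ X ^ (n : ℕ) = σ (q ((e⁻¹ : Rˣ) * x')) := by
    intro q hq hqc
    obtain ⟨ρ, hρ, hρc⟩ := exists_pow_eq hn (q e) c hc0 hqc
    have hα1 : PowerSeries.coeff 1 (X * ρ) = c := by
      have := PowerSeries.coeff_succ_X_mul 0 ρ
      rw [zero_add, PowerSeries.coeff_zero_eq_constantCoeff_apply] at this
      rw [this, hρc]
    obtain ⟨τ, σ, hτ, h⟩ := exists_isInverse (α := X * ρ) (by simp) (by rwa [hα1])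
    have hτn : τ X ^ (n : ℕ) = q (e * x) := by
      rw [hτ, mul_pow, hρ, map_mul, hq, mul_comm]
    refine ⟨τ, σ, h, by rw [hτ, hα1], hτn, ?_, ?_⟩
    · rw [← he, ← hτn, map_pow, h.comp]
    · rw [← he, ← mul_assoc, Units.inv_mul, one_mul, hq, map_pow]
  obtain ⟨τ, σ, h, h1, hτ, hσ, hσ'⟩ := reparam p hp hc
  obtain ⟨τ', σ', h', h1', hτ', hσp, hσp'⟩ := reparam p' hp' (hconst ▸ hc)
  refine mem_contacts_iff.2 ⟨n, σ.comp p, σ'.comp p', hσ, hσp, ?_, ?_, ?_⟩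
  · intro g hg
    rw [RingHom.mem_ker, AlgHom.comp_apply, RingHom.mem_ker.1 (hA hg), map_zero]
  · intro g hg
    rw [RingHom.mem_ker, AlgHom.comp_apply, RingHom.mem_ker.1 (hB hg), map_zero]
  congr 2
  apply order_eq_order_of_pow_dvd_iff
  intro m
  rw [pow_dvd_iff_of_coordinates φ (hp.trans hp'.symm),
    pow_dvd_iff_of_coordinates φ' (p := σ.comp p) (p' := σ'.comp p') (hσ.trans hσp.symm)]
  constructor
  · exact pow_dvd_reparam hn hp hp' h h' hτ hτ' (h1.trans h1'.symm)
  · intro hcong f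
    have h2 : PowerSeries.coeff 1 (σ X) = PowerSeries.coeff 1 (σ' X) := by
      have e1 := h.coeff_one_mul
      have e2 := h'.coeff_one_mul
      rw [h1] at e1
      rw [h1'] at e2
      exact mul_right_cancel₀ hc0 (e1.trans e2.symm)
    have := pow_dvd_reparam hn (p := σ.comp p) (p' := σ'.comp p') hσ hσp h.symm h'.symm hσ' hσp'
      h2 hcong f
    simpa only [AlgHom.comp_apply, h.symm.apply, h'.symm.apply] using this

/-- The contacts depend only on the axis `L = Z(x)`, not on the coordinates. If `e x` is another
equation of `L`, an arc `x = t ^ n` becomes of the form `e x = s ^ n` by taking for the new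
parameter `s` an `n`-th root of `e x`. -/
theorem contacts_eq_of_firstAxis_eq {φ φ' : Coordinates R}
    (hφ : firstAxis φ = firstAxis φ') (A B : Ideal R) : contacts φ A B = contacts φ' A B :=
  Set.Subset.antisymm (contacts_subset_of_firstAxis_eq hφ A B)
    (contacts_subset_of_firstAxis_eq hφ.symm A B)

end Contacts

/-! ### The functions on the tree -/

section TreeLemmas

variable {R : Type*} [CommRing R] [Algebra ℂ R] {φ : Coordinates R}

theorem coincidence_eq_sSup (φ : Coordinates R) (A B : Ideal R) :
    coincidence φ A B = sSup (contacts φ A B) := by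
  apply le_antisymm
  · refine iSup₂_le fun ξ hξ => iSup₂_le fun ξ' hξ' => ?_
    exact le_sSup ⟨ξ, hξ, ξ', hξ', rfl⟩
  · refine sSup_le ?_
    rintro _ ⟨ξ, hξ, ξ', hξ', rfl⟩
    exact le_iSup₂_of_le ξ hξ (le_iSup₂_of_le ξ' hξ' le_rfl)

theorem contacts_comm (φ : Coordinates R) (A B : Ideal R) : contacts φ A B = contacts φ B A := by
  have : ∀ A B : Ideal R, contacts φ A B ⊆ contacts φ B A := by
    rintro A B _ ⟨ξ, hξ, ξ', hξ', rfl⟩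
    exact ⟨ξ', hξ', ξ, hξ, orderX_sub_comm _ _⟩
  exact (this A B).antisymm (this B A)

theorem coincidence_comm (φ : Coordinates R) (A B : Ideal R) :
    coincidence φ A B = coincidence φ B A := by
  rw [coincidence_eq_sSup, coincidence_eq_sSup, contacts_comm]

theorem order_sub_nonneg {A B : Ideal R} {ξ ξ' : HahnSeries ℚ ℂ} (h : ξ ∈ roots φ A)
    (h' : ξ' ∈ roots φ B) : 0 ≤ (ξ - ξ').order := by
  obtain ⟨n, p, p', -, -, -, -, rfl, rfl⟩ := exists_common_denominator h h'
  rw [puiseux_sub]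
  rcases eq_or_ne (p (φ (MvPowerSeries.X 1)) - p' (φ (MvPowerSeries.X 1))) 0 with h0 | h0
  · rw [h0, puiseux_zero, HahnSeries.order_zero]
  · rw [order_puiseux n h0]
    positivity

theorem ofReal_rat_injective {q r : ℚ} (hq : 0 ≤ q) (hr : 0 ≤ r)
    (h : ENNReal.ofReal (q : ℝ) = ENNReal.ofReal (r : ℝ)) : q = r := by
  have hq' : (0 : ℝ) ≤ q := by exact_mod_cast hq
  have hr' : (0 : ℝ) ≤ r := by exact_mod_cast hr
  exact_mod_cast (ENNReal.ofReal_eq_ofReal_iff hq' hr').1 h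

/-- The contacts of a branch with itself are its characteristic exponents and `∞`. -/
theorem mem_charExponents_iff {A : Ideal R} {q : ℚ} :
    q ∈ charExponents φ A ↔ 0 ≤ q ∧ ENNReal.ofReal (q : ℝ) ∈ contacts φ A A := by
  constructor
  · rintro ⟨ξ, hξ, ξ', hξ', hne, rfl⟩
    exact ⟨order_sub_nonneg hξ hξ', ξ, hξ, ξ', hξ', (orderX_of_ne_zero (sub_ne_zero.2 hne)).symm⟩
  · rintro ⟨hq, ξ, hξ, ξ', hξ', h⟩
    have hne : ξ - ξ' ≠ 0 := by
      intro h0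
      rw [h0, orderX_zero] at h
      exact ENNReal.ofReal_ne_top h
    refine ⟨ξ, hξ, ξ', hξ', sub_ne_zero.1 hne, ?_⟩
    rw [orderX_of_ne_zero hne] at h
    exact ofReal_rat_injective hq (order_sub_nonneg hξ hξ') h

/-- The contact with `B` does not depend on the root of the branch `A` from which it is seen. -/
theorem exists_root_orderX_eq {A B : Ideal R} (hA : IsBranch A) {ξ ξ' ξ₁ : HahnSeries ℚ ℂ}
    (h : ξ ∈ roots φ A) (h' : ξ' ∈ roots φ B) (h₁ : ξ₁ ∈ roots φ A) :
    ∃ ξ₁' ∈ roots φ B, orderX (ξ₁ - ξ₁') = orderX (ξ - ξ') := by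
  obtain ⟨k, rfl⟩ := exists_eq_twist hA h h₁
  exact ⟨twist k ξ', twist_mem_roots h' k, by rw [← twist_sub, orderX_twist]⟩

theorem exists_lt_orderX {A B : Ideal R} {r : ℝ≥0∞} (h : r < coincidence φ A B) :
    ∃ ξ ∈ roots φ A, ∃ ξ' ∈ roots φ B, r < orderX (ξ - ξ') := by
  rw [coincidence_eq_sSup, lt_sSup_iff] at h
  obtain ⟨_, ⟨ξ, hξ, ξ', hξ', rfl⟩, hr⟩ := h
  exact ⟨ξ, hξ, ξ', hξ', hr⟩

/-- The orders of coincidence satisfy the ultrametric inequality. -/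
theorem min_le_coincidence {A B D : Ideal R} (hB : IsBranch B) :
    min (coincidence φ A B) (coincidence φ B D) ≤ coincidence φ A D := by
  refine le_of_forall_lt fun r hr => ?_
  rw [lt_min_iff] at hr
  obtain ⟨ξ, hξ, ξ', hξ', h1⟩ := exists_lt_orderX hr.1
  obtain ⟨ρ, hρ, ρ', hρ', h2⟩ := exists_lt_orderX hr.2
  obtain ⟨ρ₁, hρ₁, h3⟩ := exists_root_orderX_eq hB hρ hρ' hξ'
  rw [← h3] at h2
  refine (lt_min h1 h2).trans_le ((min_le_orderX_sub ξ ξ' ρ₁).trans ?_)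
  rw [coincidence_eq_sSup]
  exact le_sSup ⟨ξ, hξ, ρ₁, hρ₁, rfl⟩

theorem orderX_eq_of_lt {η η' : HahnSeries ℚ ℂ} (h : orderX η < orderX (η - η')) :
    orderX η' = orderX η := by
  apply le_antisymm
  · by_contra hlt
    have := min_le_orderX_add (η - η') η'
    rw [sub_add_cancel] at this
    exact absurd ((lt_min h (not_le.1 hlt)).trans_le this) (lt_irrefl _)
  · have := min_le_orderX_add η (-(η - η'))
    rw [orderX_neg, min_eq_left h.le] at this
    simpa using this

/-- Two branches have the same characteristic exponents below their order of coincidence. -/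
theorem mem_charExponents_of_lt_coincidence {A B : Ideal R} (hA : IsBranch A) {q : ℚ}
    (hq : q ∈ charExponents φ A) (hlt : ENNReal.ofReal (q : ℝ) < coincidence φ A B) :
    q ∈ charExponents φ B := by
  rw [mem_charExponents_iff] at hq ⊢
  obtain ⟨hq0, ξ₁, hξ₁, ξ₂, hξ₂, hq⟩ := hq
  obtain ⟨ξ, hξ, ξ', hξ', h⟩ := exists_lt_orderX hlt
  obtain ⟨ξ₁', hξ₁', h1⟩ := exists_root_orderX_eq hA hξ hξ' hξ₁
  obtain ⟨ξ₂', hξ₂', h2⟩ := exists_root_orderX_eq hA hξ hξ' hξ₂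
  refine ⟨hq0, ξ₁', hξ₁', ξ₂', hξ₂', ?_⟩
  have h3 : orderX (ξ₁' - ξ₂) = orderX (ξ₁ - ξ₂) := by
    apply orderX_eq_of_lt
    rw [sub_sub_sub_cancel_right, h1, ← hq]
    exact h
  rw [orderX_eq_of_lt (η := ξ₁' - ξ₂), h3, hq]
  rw [sub_sub_sub_cancel_left, orderX_sub_comm ξ₂', h2, h3, ← hq]
  exact h

/-- The index functions of two branches agree on the common part of their segments. -/
theorem indexOn_eq_of_le_coincidence {A B : Ideal R} (hA : IsBranch A) (hB : IsBranch B)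
    {s : ℝ≥0∞} (hs : s ≤ coincidence φ A B) : indexOn φ A s = indexOn φ B s := by
  have h : ∀ q : ℚ, ENNReal.ofReal (q : ℝ) < s →
      (q ∈ charExponents φ A ↔ q ∈ charExponents φ B) := fun q hq =>
    ⟨fun h => mem_charExponents_of_lt_coincidence hA h (hq.trans_le hs),
      fun h => mem_charExponents_of_lt_coincidence hB h
        ((hq.trans_le hs).trans_eq (coincidence_comm φ A B))⟩
  unfold indexOn
  congr 1
  ext N
  refine and_congr_right fun _ => ⟨fun hN q hq hqs => hN q ((h q hqs).2 hq) hqs,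
    fun hN q hq hqs => hN q ((h q hqs).1 hq) hqs⟩

theorem measurableSet_segment (s : ℝ≥0∞) : MeasurableSet {t : ℝ | 0 < t ∧ ENNReal.ofReal t < s} :=
  (measurableSet_lt measurable_const measurable_id).inter
    (measurableSet_lt ENNReal.measurable_ofReal measurable_const)

theorem contactOn_eq_of_le_coincidence {A B : Ideal R} (hA : IsBranch A) (hB : IsBranch B)
    {s : ℝ≥0∞} (hs : s ≤ coincidence φ A B) : contactOn φ A s = contactOn φ B s := by
  apply MeasureTheory.setLIntegral_congr_fun (measurableSet_segment s)
  intro t ht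
  simp only
  rw [indexOn_eq_of_le_coincidence hA hB (ht.2.le.trans hs)]

theorem den_dvd_iff {q : ℚ} {N : ℕ} : q.den ∣ N ↔ ∃ z : ℤ, q * N = z := by
  constructor
  · rintro ⟨k, rfl⟩
    refine ⟨q.num * k, ?_⟩
    push_cast
    rw [← mul_assoc, Rat.mul_den_eq_num]
  · rintro ⟨z, hz⟩
    rcases eq_or_ne N 0 with rfl | hN
    · exact dvd_zero _
    · have hq : q = (z : ℚ) / ((N : ℤ) : ℚ) := by
        rw [eq_div_iff (by exact_mod_cast hN)]
        exact_mod_cast hz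
      have := Rat.den_dvd z N
      rw [hq]
      rw [Rat.divInt_eq_div] at this
      exact_mod_cast this

/-- The characteristic exponents of a branch have a common denominator. -/
theorem exists_den_dvd {A : Ideal R} (hA : IsBranch A) :
    ∃ N : ℕ, 0 < N ∧ ∀ q ∈ charExponents φ A, q.den ∣ N := by
  rcases (roots φ A).eq_empty_or_nonempty with h | ⟨ξ₀, h₀⟩
  · refine ⟨1, one_pos, ?_⟩
    rintro q ⟨ξ, hξ, -⟩
    rw [h] at hξ
    exact absurd hξ (Set.notMem_empty ξ)
  · obtain ⟨n, p, -, -, hξ₀⟩ := mem_roots_iff.1 h₀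
    refine ⟨n, n.pos, ?_⟩
    rintro q ⟨ξ, hξ, ξ', hξ', hne, rfl⟩
    obtain ⟨k, rfl⟩ := exists_eq_twist hA h₀ hξ
    obtain ⟨k', rfl⟩ := exists_eq_twist hA h₀ hξ'
    rw [hξ₀, twist_puiseux, twist_puiseux] at hne ⊢
    rw [puiseux_sub, order_puiseux n (fun h0 => hne (by rw [sub_eq_zero.1 h0]))]
    rw [den_dvd_iff]
    exact ⟨((PowerSeries.order _).toNat : ℤ), by
      rw [div_mul_cancel₀ _ (by exact_mod_cast n.ne_zero)]; rfl⟩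

/-- The infimum which defines the index is attained. -/
theorem indexOn_spec {A : Ideal R} (hA : IsBranch A) (s : ℝ≥0∞) :
    0 < indexOn φ A s ∧
      ∀ q ∈ charExponents φ A, ENNReal.ofReal (q : ℝ) < s → q.den ∣ indexOn φ A s := by
  obtain ⟨N, hN, h⟩ := exists_den_dvd (φ := φ) hA
  exact Nat.sInf_mem (s := {N : ℕ | 0 < N ∧ ∀ q ∈ charExponents φ A,
    ENNReal.ofReal (q : ℝ) < s → q.den ∣ N}) ⟨N, hN, fun q hq _ => h q hq⟩

theorem exists_indexOn_le {A : Ideal R} (hA : IsBranch A) :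
    ∃ N : ℕ, 0 < N ∧ ∀ s, indexOn φ A s ≤ N := by
  obtain ⟨N, hN, h⟩ := exists_den_dvd (φ := φ) hA
  exact ⟨N, hN, fun s => Nat.sInf_le ⟨hN, fun q hq _ => h q hq⟩⟩

theorem indexOn_eq_one {A : Ideal R} {s : ℝ≥0∞}
    (h : ∀ q ∈ charExponents φ A, s ≤ ENNReal.ofReal (q : ℝ)) : indexOn φ A s = 1 := by
  have : {N : ℕ | 0 < N ∧ ∀ q ∈ charExponents φ A, ENNReal.ofReal (q : ℝ) < s → q.den ∣ N} =
      {N | 0 < N} := by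
    ext N
    exact and_iff_left fun q hq hlt => absurd hlt (not_lt.2 (h q hq))
  rw [indexOn, this]
  apply le_antisymm
  · exact Nat.sInf_le (Nat.one_pos : 0 < 1)
  · exact Nat.sInf_mem (⟨1, Nat.one_pos⟩ : {N : ℕ | 0 < N}.Nonempty)

theorem contactOn_ne_top {A : Ideal R} (hA : IsBranch A) {s : ℝ≥0∞} (hs : s ≠ ⊤) :
    contactOn φ A s ≠ ⊤ := by
  have h1 : contactOn φ A s ≤ ∫⁻ _ in Set.Ioo 0 s.toReal, 1 := by
    refine (MeasureTheory.lintegral_mono fun t => ?_).trans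
      (MeasureTheory.lintegral_mono_set (fun t ht => ⟨ht.1, ?_⟩))
    · exact ENNReal.inv_le_one.2 (by exact_mod_cast (indexOn_spec hA _).1)
    · exact (ENNReal.ofReal_lt_iff_lt_toReal ht.1.le hs).1 ht.2
  refine ne_top_of_le_ne_top ?_ h1
  simp

/-- The integrand is bounded below by a positive constant, and the integral is finite for a finite
exponent. -/
theorem contactOn_strictMono {A : Ideal R} (hA : IsBranch A) : StrictMono (contactOn φ A) := by
  intro s s' h
  obtain ⟨N, hN, hle⟩ := exists_indexOn_le (φ := φ) hA
  obtain ⟨r, hsr, hrs⟩ := ENNReal.lt_iff_exists_nnreal_btwn.1 h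
  have hs : s ≠ ⊤ := hsr.ne_top
  set D : Set ℝ := Set.Ioo s.toReal r with hD
  have hdisj : Disjoint {t : ℝ | 0 < t ∧ ENNReal.ofReal t < s} D := by
    rw [Set.disjoint_left]
    intro t ht htD
    exact lt_asymm ((ENNReal.ofReal_lt_iff_lt_toReal ht.1.le hs).1 ht.2) htD.1
  have hsub : {t : ℝ | 0 < t ∧ ENNReal.ofReal t < s} ∪ D ⊆
      {t : ℝ | 0 < t ∧ ENNReal.ofReal t < s'} := by
    rintro t (ht | ht)
    · exact ⟨ht.1, ht.2.trans h⟩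
    · refine ⟨ENNReal.toReal_nonneg.trans_lt ht.1, lt_trans ?_ hrs⟩
      rw [ENNReal.ofReal_lt_iff_lt_toReal (ENNReal.toReal_nonneg.trans ht.1.le) ENNReal.coe_ne_top]
      exact ht.2
  have h1 := MeasureTheory.lintegral_mono_set (μ := MeasureTheory.volume) hsub
    (f := fun t => ((indexOn φ A (ENNReal.ofReal t) : ℕ) : ℝ≥0∞)⁻¹)
  rw [MeasureTheory.lintegral_union measurableSet_Ioo hdisj] at h1
  refine lt_of_lt_of_le (ENNReal.lt_add_right (contactOn_ne_top hA hs) ?_) h1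
  have h2 : ∫⁻ _ in D, ((N : ℕ) : ℝ≥0∞)⁻¹ ≤
      ∫⁻ t in D, ((indexOn φ A (ENNReal.ofReal t) : ℕ) : ℝ≥0∞)⁻¹ :=
    MeasureTheory.lintegral_mono fun t => ENNReal.inv_le_inv.2 (by exact_mod_cast hle _)
  refine (lt_of_lt_of_le ?_ h2).ne'
  rw [MeasureTheory.setLIntegral_const, hD, Real.volume_Ioo]
  refine ENNReal.mul_pos ?_ ?_
  · simp
  · have : s.toReal < r := by
      have := (ENNReal.toReal_lt_toReal hs ENNReal.coe_ne_top).2 hsr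
      simpa using this
    simpa using this

variable {C : Ideal R}

theorem Identified.symm {p q : SegmentPoint φ C} (h : Identified φ C p q) : Identified φ C q p :=
  ⟨h.1.symm, by rw [← h.1, coincidence_comm]; exact h.2⟩

theorem Identified.trans {p q r : SegmentPoint φ C} (h : Identified φ C p q)
    (h' : Identified φ C q r) : Identified φ C p r :=
  ⟨h.1.trans h'.1, (le_min h.2 (h.1.trans_le h'.2)).trans (min_le_coincidence q.branch.2.1)⟩

/-- By the ultrametric inequality the relation `Identified` is transitive, so that the points of the
tree are its classes and no further identifications arise. -/
theorem Tree.mk_eq_mk_iff {p q : SegmentPoint φ C} :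
    Tree.mk p = Tree.mk q ↔ p = q ∨ Identified φ C p q := by
  constructor
  · intro h
    have h' := Quot.eqvGen_exact h
    clear h
    induction h' with
    | rel _ _ h => exact Or.inr h
    | refl _ => exact Or.inl rfl
    | symm _ _ _ ih => exact ih.imp Eq.symm Identified.symm
    | trans _ _ _ _ _ ih ih' =>
      rcases ih with rfl | ih
      · exact ih'
      · rcases ih' with rfl | ih'
        · exact Or.inr ih
        · exact Or.inr (ih.trans ih')
  · rintro (rfl | h)
    · rfl
    · exact Quot.sound h

theorem Tree.index_mk (p : SegmentPoint φ C) :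
    (Tree.mk p).index = indexOn φ p.branch.1 p.exponent := by
  have : {i | ∃ p' : SegmentPoint φ C, Tree.mk p' = Tree.mk p ∧
      i = indexOn φ p'.branch.1 p'.exponent} = {indexOn φ p.branch.1 p.exponent} := by
    ext i
    constructor
    · rintro ⟨p', hp', rfl⟩
      rcases Tree.mk_eq_mk_iff.1 hp' with rfl | h
      · rfl
      · rw [Set.mem_singleton_iff, indexOn_eq_of_le_coincidence p'.branch.2.1 p.branch.2.1 h.2, h.1]
    · rintro rfl
      exact ⟨p, rfl, rfl⟩
  rw [Tree.index, this, csInf_singleton]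

theorem Tree.contact_mk (p : SegmentPoint φ C) :
    (Tree.mk p).contact = contactOn φ p.branch.1 p.exponent := by
  have : {k | ∃ p' : SegmentPoint φ C, Tree.mk p' = Tree.mk p ∧
      k = contactOn φ p'.branch.1 p'.exponent} = {contactOn φ p.branch.1 p.exponent} := by
    ext i
    constructor
    · rintro ⟨p', hp', rfl⟩
      rcases Tree.mk_eq_mk_iff.1 hp' with rfl | h
      · rfl
      · rw [Set.mem_singleton_iff, contactOn_eq_of_le_coincidence p'.branch.2.1 p.branch.2.1 h.2,
          h.1]
    · rintro rfl
      exact ⟨p, rfl, rfl⟩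
  rw [Tree.contact, this, csInf_singleton]

end TreeLemmas

/-! ### The image of a branch under the toric morphism -/

theorem exists_plane_endo (f g : FormalPlane) (hf : MvPowerSeries.constantCoeff f = 0)
    (hg : MvPowerSeries.constantCoeff g = 0) :
    ∃ p : FormalPlane →ₐ[ℂ] FormalPlane, p (MvPowerSeries.X 0) = f ∧ p (MvPowerSeries.X 1) = g := by
  have hs : MvPowerSeries.HasSubst (![f, g] : Fin 2 → FormalPlane) := by
    apply MvPowerSeries.hasSubst_of_constantCoeff_zero
    intro i
    fin_cases i
    · exact hf
    · exact hg
  exact ⟨MvPowerSeries.substAlgHom hs, MvPowerSeries.substAlgHom_X hs 0,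
    MvPowerSeries.substAlgHom_X hs 1⟩

/-- A `c`-th root of the coordinate `v`. -/
theorem exists_root_of_coordinate {c : ℕ} (hc : c ≠ 0) {γ γ₁ : ℂ} (hγ₁ : γ₁ ≠ 0) (h : γ₁ ^ c = γ) :
    ∃ r : FormalPlane, r ^ c = MvPowerSeries.C γ + MvPowerSeries.X 1 ∧
      MvPowerSeries.constantCoeff r = γ₁ := by
  obtain ⟨r, hr, hr1⟩ := exists_pow_eq hc (C γ + X) γ₁ hγ₁ (by simp [h])
  have hs : PowerSeries.HasSubst (MvPowerSeries.X 1 : FormalPlane) := PowerSeries.HasSubst.X 1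
  set j : PowerSeries ℂ →ₐ[ℂ] FormalPlane := PowerSeries.substAlgHom hs with hj
  have hjX : j X = MvPowerSeries.X 1 := PowerSeries.substAlgHom_X hs
  have hjC : ∀ z : ℂ, j (C z) = MvPowerSeries.C z := by
    intro z
    have := j.commutes z
    rwa [PowerSeries.algebraMap_apply, MvPowerSeries.algebraMap_apply] at this
  refine ⟨j r, by rw [← map_pow, hr, map_add, hjX, hjC], ?_⟩
  obtain ⟨s, hs⟩ := PowerSeries.X_dvd_iff.2 (show constantCoeff (r - C γ₁) = 0 by simp [hr1])
  rw [sub_eq_iff_eq_add.1 hs, map_add, map_mul, hjX, hjC]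
  simp

theorem eq_of_pow_eq_of_constantCoeff_eq {c : ℕ} (hc : c ≠ 0) {r s : FormalPlane}
    (h : r ^ c = s ^ c) (h0 : MvPowerSeries.constantCoeff r = MvPowerSeries.constantCoeff s)
    (hs : MvPowerSeries.constantCoeff s ≠ 0) : r = s := by
  have h1 := Commute.mul_geom_sum₂ (Commute.all r s) c
  rw [h, sub_self] at h1
  refine sub_eq_zero.1 ((mul_eq_zero.1 h1).resolve_right fun h2 => ?_)
  have h3 := congrArg MvPowerSeries.constantCoeff h2
  rw [map_sum, map_zero] at h3
  have : ∀ i ∈ Finset.range c, MvPowerSeries.constantCoeff (r ^ i * s ^ (c - 1 - i)) =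
      MvPowerSeries.constantCoeff s ^ (c - 1) := by
    intro i hi
    rw [map_mul, map_pow, map_pow, h0, ← pow_add]
    congr 1
    have := Finset.mem_range.1 hi
    omega
  rw [Finset.sum_congr rfl this] at h3
  simp [hc, hs] at h3

/-- There are coordinates `(u₁, v₁)` at the point `o_w` in which the toric morphism takes the form
`x = u₁ ^ c`, `y = u₁ ^ d (γ₁ + v₁)`. -/
theorem exists_adapted_coordinates (w : Weight) {γ : ℂ} (hγ : γ ≠ 0) :
    ∃ (γ₁ : ℂ) (ψ : Coordinates FormalPlane), γ₁ ≠ 0 ∧ firstAxis ψ = exceptional ∧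
      ψ (MvPowerSeries.X 0) ^ w.c = chartMap w γ 0 ∧
      ψ (MvPowerSeries.X 0) ^ w.d * (MvPowerSeries.C γ₁ + ψ (MvPowerSeries.X 1)) =
        chartMap w γ 1 := by
  have hc := w.c_pos.ne'
  obtain ⟨γ₁, h⟩ := IsAlgClosed.exists_pow_nat_eq γ w.c_pos
  have hγ₁ : γ₁ ≠ 0 := by
    rintro rfl
    rw [zero_pow hc] at h
    exact hγ h.symm
  obtain ⟨r, hr, hr1⟩ := exists_root_of_coordinate hc hγ₁ h
  obtain ⟨U, hU⟩ : IsUnit (MvPowerSeries.C γ₁ + MvPowerSeries.X 1 : FormalPlane) := by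
    rw [MvPowerSeries.isUnit_iff_constantCoeff]
    simpa using hγ₁
  obtain ⟨F, hF0, hF1⟩ := exists_plane_endo (MvPowerSeries.X 0 * r ^ w.a)
    (r - MvPowerSeries.C γ₁) (by simp) (by simp [hr1])
  obtain ⟨G, hG0, hG1⟩ := exists_plane_endo
    (MvPowerSeries.X 0 * ((U⁻¹ ^ w.a : FormalPlaneˣ) : FormalPlane))
    ((U : FormalPlane) ^ w.c - MvPowerSeries.C γ) (by simp) (by simp [hU, h])
  have hC : ∀ (H : FormalPlane →ₐ[ℂ] FormalPlane) (z : ℂ),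
      H (MvPowerSeries.C z) = MvPowerSeries.C z := by
    intro H z
    have := H.commutes z
    rwa [MvPowerSeries.algebraMap_apply] at this
  have hFU : F U = r := by rw [hU, map_add, hC, hF1]; ring
  have hGr : G r = U := by
    refine eq_of_pow_eq_of_constantCoeff_eq hc ?_ ?_ ?_
    · rw [← map_pow, hr, map_add, hC, hG1]; ring
    · rw [constantCoeff_plane_endo, hr1, hU]
      · simp
      · intro i
        fin_cases i
        · simp [hG0]
        · simp [hG1, hU, h]
    · rw [hU]; simpa using hγ₁
  have hFG : F.comp G = AlgHom.id ℂ _ := by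
    apply plane_endo_ext (by simp)
    intro i
    fin_cases i
    · have h1 : F (U⁻¹ ^ w.a : FormalPlaneˣ) * r ^ w.a = 1 := by
        rw [← hFU, ← map_pow, ← map_mul, ← Units.val_pow_eq_pow_val, ← Units.val_mul]
        simp
      simp only [Fin.zero_eta, AlgHom.comp_apply, AlgHom.id_apply, hG0, map_mul, hF0]
      rw [mul_assoc, mul_comm (r ^ w.a), h1, mul_one]
    · simp only [Fin.mk_one, AlgHom.comp_apply, AlgHom.id_apply, hG1, map_sub, map_pow, hC, hFU, hr]
      ring
  have hGF : G.comp F = AlgHom.id ℂ _ := by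
    apply plane_endo_ext (by simp)
    intro i
    fin_cases i
    · simp only [Fin.zero_eta, AlgHom.comp_apply, AlgHom.id_apply, hF0, map_mul, hG0, map_pow, hGr]
      rw [mul_assoc, ← Units.val_pow_eq_pow_val, ← Units.val_mul]
      simp
    · simp only [Fin.mk_one, AlgHom.comp_apply, AlgHom.id_apply, hF1, map_sub, hC, hGr, hU]
      ring
  refine ⟨γ₁, AlgEquiv.ofAlgHom F G hFG hGF, hγ₁, ?_, ?_, ?_⟩
  · rw [firstAxis, exceptional, Ideal.span_singleton_eq_span_singleton]
    have hru : IsUnit r := by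
      rw [MvPowerSeries.isUnit_iff_constantCoeff, hr1]; exact hγ₁.isUnit
    simp only [AlgEquiv.ofAlgHom_apply, hF0]
    exact (associated_mul_unit_left _ _ (hru.pow w.a))
  · simp only [AlgEquiv.ofAlgHom_apply, hF0, chartMap, Matrix.cons_val_zero]
    rw [mul_pow, ← pow_mul, mul_comm w.a, pow_mul, hr]
  · simp only [AlgEquiv.ofAlgHom_apply, hF0, hF1, chartMap, Matrix.cons_val_one, add_sub_cancel]
    rw [mul_pow, ← pow_mul, mul_assoc, ← pow_succ, ← w.basis, mul_comm w.b, pow_mul, hr]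
    simp

/-- The multiplicity `c` of the coordinate `x` along the exceptional divisor, as a positive
number. -/
def Weight.denom (w : Weight) : ℕ+ := ⟨w.c, w.c_pos⟩

theorem Weight.denom_coe (w : Weight) : (w.denom : ℕ) = w.c := rfl

/-- The lift `y = x ^ (d / c) (γ₁ + v₁)` of the root `v₁ = ζ (u₁ ^ (1 / n))` of a branch, where
`x = u₁ ^ c`; it is a root of the image of that branch. -/
def toricLift (w : Weight) (γ₁ : ℂ) (n : ℕ+) (ζ : PowerSeries ℂ) : HahnSeries ℚ ℂ :=
  puiseux (n * w.denom) (X ^ ((n : ℕ) * w.d) * (C γ₁ + ζ))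

theorem Weight.coprime (w : Weight) : Nat.Coprime w.c w.d := by
  rw [Nat.coprime_iff_isRelPrime]
  intro k hc hd
  have h1 : k ∣ w.a * w.d + 1 := w.basis ▸ Dvd.dvd.mul_left hc _
  exact isUnit_of_dvd_one ((Nat.dvd_add_right (Dvd.dvd.mul_left hd _)).1 h1)

theorem orderX_toric (w : Weight) (n : ℕ+) (f : PowerSeries ℂ) :
    orderX (puiseux (n * w.denom) (X ^ ((n : ℕ) * w.d) * f)) =
      orderX (puiseux n f) / (w.c : ℝ≥0∞) + (w.d : ℝ≥0∞) / w.c := by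
  rw [orderX_puiseux, orderX_puiseux, PowerSeries.order_mul, PowerSeries.order_X_pow]
  have hn : ((n : ℕ) : ℝ≥0∞) ≠ 0 := by exact_mod_cast n.ne_zero
  have hn' : ((n : ℕ) : ℝ≥0∞) ≠ ⊤ := ENNReal.natCast_ne_top _
  push_cast
  rw [w.denom_coe, add_comm, ENNReal.add_div, ENNReal.mul_div_mul_left _ _ hn hn']
  congr 1
  simp only [div_eq_mul_inv]
  rw [ENNReal.mul_inv (Or.inl hn) (Or.inl hn'), mul_assoc]

theorem rescale_toric (w : Weight) (γ₁ : ℂ) (n : ℕ+) (ω : ℂ) (ζ : PowerSeries ℂ) :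
    PowerSeries.rescale ω (X ^ ((n : ℕ) * w.d) * (C γ₁ + ζ)) =
      X ^ ((n : ℕ) * w.d) * (C (ω ^ ((n : ℕ) * w.d)) * (C γ₁ + PowerSeries.rescale ω ζ)) := by
  rw [map_mul, map_pow, PowerSeries.rescale_X, map_add, mul_pow, map_pow]
  have : PowerSeries.rescale ω (C γ₁) = C γ₁ := by
    ext k
    rw [PowerSeries.coeff_rescale, PowerSeries.coeff_C]
    split_ifs with hk
    · rw [hk, pow_zero, one_mul]
    · rw [mul_zero]
  rw [this]; ring

/-- The powers of the monodromy divisible by `c` come from the monodromy of the branches at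
`o_w`. -/
theorem orderX_toricLift_sub_twist (w : Weight) (γ₁ : ℂ) (n : ℕ+) (ζ ζ' : PowerSeries ℂ) (m : ℤ) :
    orderX (toricLift w γ₁ n ζ - twist (w.c * m) (toricLift w γ₁ n ζ')) =
      orderX (puiseux n ζ - twist m (puiseux n ζ')) / (w.c : ℝ≥0∞) + (w.d : ℝ≥0∞) / w.c := by
  have hn : ((n : ℕ) : ℂ) ≠ 0 := by exact_mod_cast n.ne_zero
  have hc : (w.c : ℂ) ≠ 0 := by exact_mod_cast w.c_pos.ne'
  have e : 2 * Real.pi * Complex.I * (((w.c * m : ℤ) : ℂ) / ((n * w.denom : ℕ+) : ℕ)) =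
      2 * Real.pi * Complex.I * (m / (n : ℕ)) := by
    push_cast
    rw [w.denom_coe]
    field_simp
  have h1 : Complex.exp (2 * Real.pi * Complex.I * (m / (n : ℕ))) ^ ((n : ℕ) * w.d) = 1 := by
    rw [← Complex.exp_nat_mul, Complex.exp_eq_one_iff]
    refine ⟨m * w.d, ?_⟩
    push_cast
    field_simp
  rw [toricLift, toricLift, twist_puiseux, twist_puiseux, e, rescale_toric, h1, puiseux_sub,
    puiseux_sub, ← mul_sub, map_one, one_mul, add_sub_add_left_eq_sub, orderX_toric]

/-- The other powers of the monodromy already move the initial coefficient `γ₁` of the lifts. -/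
theorem orderX_toricLift_sub_twist_of_not_dvd (w : Weight) {γ₁ : ℂ} (hγ₁ : γ₁ ≠ 0) (n : ℕ+)
    {ζ ζ' : PowerSeries ℂ} (hζ : constantCoeff ζ = 0) (hζ' : constantCoeff ζ' = 0) {l : ℤ}
    (hl : ¬ (w.c : ℤ) ∣ l) :
    orderX (toricLift w γ₁ n ζ - twist l (toricLift w γ₁ n ζ')) = (w.d : ℝ≥0∞) / w.c := by
  have hn : ((n : ℕ) : ℂ) ≠ 0 := by exact_mod_cast n.ne_zero
  have hc : (w.c : ℂ) ≠ 0 := by exact_mod_cast w.c_pos.ne'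
  rw [toricLift, toricLift, twist_puiseux, rescale_toric, puiseux_sub, ← mul_sub, orderX_toric,
    orderX_puiseux]
  set ω := Complex.exp (2 * Real.pi * Complex.I * (l / ((n * w.denom : ℕ+) : ℕ))) with hω
  have hω1 : ω ^ ((n : ℕ) * w.d) ≠ 1 := by
    rw [hω, ← Complex.exp_nat_mul, Ne, Complex.exp_eq_one_iff]
    rintro ⟨z, hz⟩
    apply hl
    have h2 : (2 * Real.pi * Complex.I : ℂ) ≠ 0 := Complex.two_pi_I_ne_zero
    have h3 : (l * w.d : ℂ) = z * w.c := by
      push_cast at hz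
      rw [w.denom_coe] at hz
      apply mul_left_cancel₀ h2
      field_simp at hz ⊢
      linear_combination hz
    have h4 : l * w.d = w.c * z := by
      have : l * w.d = z * w.c := by exact_mod_cast h3
      rw [this, mul_comm]
    exact (Nat.isCoprime_iff_coprime.2 w.coprime).dvd_of_dvd_mul_right ⟨z, h4⟩
  have hord :
      (C γ₁ + ζ - C (ω ^ ((n : ℕ) * w.d)) * (C γ₁ + PowerSeries.rescale ω ζ')).order = 0 := by
    by_contra h0
    have h1 := PowerSeries.order_ne_zero_iff_constCoeff_eq_zero.1 h0
    have h2 : constantCoeff (PowerSeries.rescale ω ζ') = 0 := by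
      rw [← PowerSeries.coeff_zero_eq_constantCoeff_apply, PowerSeries.coeff_rescale]
      simp [hζ']
    rw [map_sub, map_mul, map_add, map_add, h2, hζ] at h1
    simp only [PowerSeries.constantCoeff_C, add_zero] at h1
    apply hω1
    apply mul_right_cancel₀ hγ₁
    rw [one_mul]
    exact (sub_eq_zero.1 h1).symm
  rw [hord]
  simp

section Image

variable {R : Type*} [CommRing R] [Algebra ℂ R]

theorem image_ker (κ : Coordinates R) (w : Weight) (γ : ℂ) (q : FormalPlane →ₐ[ℂ] PowerSeries ℂ) :
    image κ w γ (RingHom.ker q) = RingHom.ker (q.comp (pullback κ w γ)) := rfl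

theorem pullback_X (κ : Coordinates R) (w : Weight) (γ : ℂ) (i : Fin 2) :
    pullback κ w γ (κ (MvPowerSeries.X i)) = chartMap w γ i := by
  have h : pullback κ w γ (κ (MvPowerSeries.X i)) =
      MvPowerSeries.substAlgHom (hasSubst_chartMap w γ)
        (κ.symm (κ (MvPowerSeries.X i))) := rfl
  rw [h, AlgEquiv.symm_apply_apply, MvPowerSeries.substAlgHom_X]

/-- The parametrization of the image of a parametrized branch. -/
theorem arc_pullback {κ : Coordinates R} {w : Weight} {γ γ₁ : ℂ}
    {ψ : Coordinates FormalPlane} (h0 : ψ (MvPowerSeries.X 0) ^ w.c = chartMap w γ 0)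
    (h1 : ψ (MvPowerSeries.X 0) ^ w.d * (MvPowerSeries.C γ₁ + ψ (MvPowerSeries.X 1)) =
      chartMap w γ 1) {n : ℕ+} {q : FormalPlane →ₐ[ℂ] PowerSeries ℂ}
    (hq : q (ψ (MvPowerSeries.X 0)) = X ^ (n : ℕ)) :
    q (pullback κ w γ (κ (MvPowerSeries.X 0))) = X ^ ((n * w.denom : ℕ+) : ℕ) ∧
    q (pullback κ w γ (κ (MvPowerSeries.X 1))) =
      X ^ ((n : ℕ) * w.d) * (C γ₁ + q (ψ (MvPowerSeries.X 1))) := by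
  have hC : q (MvPowerSeries.C γ₁) = C γ₁ := by
    have := q.commutes γ₁
    rwa [PowerSeries.algebraMap_apply, MvPowerSeries.algebraMap_apply] at this
  rw [pullback_X, pullback_X, ← h0, ← h1, map_pow, map_mul, map_pow, hq, map_add, hC, ← pow_mul,
    ← pow_mul]
  exact ⟨rfl, rfl⟩

theorem ne_firstAxis_of_le_ker {φ : Coordinates R} {A : Ideal R} {n : ℕ}
    {p : R →ₐ[ℂ] PowerSeries ℂ} (hp : p (φ (MvPowerSeries.X 0)) = X ^ n)
    (hA : A ≤ RingHom.ker p) : A ≠ firstAxis φ := by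
  rintro rfl
  exact firstAxis_not_le_ker hp hA

theorem isBranch_image (κ : Coordinates R) (w : Weight) {γ : ℂ} (hγ : γ ≠ 0)
    {Aw : Ideal FormalPlane} (hAw : IsBranch Aw) (hE : Aw ≠ exceptional) :
    IsBranch (image κ w γ Aw) ∧ image κ w γ Aw ≠ firstAxis κ := by
  obtain ⟨γ₁, ψ, -, hψ, h0, h1⟩ := exists_adapted_coordinates w hγ
  obtain ⟨η, hη⟩ := roots_nonempty (φ := ψ) hAw (by rwa [hψ])
  obtain ⟨n, q, hq, hqA, -⟩ := mem_roots_iff.1 hη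
  have hp := (arc_pullback (κ := κ) h0 h1 hq).1
  rw [← ker_eq_of_isBranch ψ hAw n.ne_zero hq hqA, image_ker]
  exact ⟨isBranch_ker κ (n * w.denom).ne_zero _ hp, ne_firstAxis_of_le_ker hp le_rfl⟩

/-- The contacts of the images of two branches are the contacts of the branches, transformed by
`s ↦ s / c + d / c`, and `d / c`, the latter unless `c = 1`. -/
theorem contacts_image (κ : Coordinates R) (w : Weight) {γ : ℂ} (hγ : γ ≠ 0)
    {φ : Coordinates R} (hφ : firstAxis φ = firstAxis κ)
    {ψ : Coordinates FormalPlane} (hψ : firstAxis ψ = exceptional)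
    {Aw Bw : Ideal FormalPlane} (hAw : IsBranch Aw) (hAE : Aw ≠ exceptional)
    (hBw : IsBranch Bw) (hBE : Bw ≠ exceptional) :
    (∀ s ∈ contacts ψ Aw Bw, s / (w.c : ℝ≥0∞) + (w.d : ℝ≥0∞) / w.c ∈
      contacts φ (image κ w γ Aw) (image κ w γ Bw)) ∧
    (∀ s ∈ contacts φ (image κ w γ Aw) (image κ w γ Bw), s = (w.d : ℝ≥0∞) / w.c ∨
      ∃ s' ∈ contacts ψ Aw Bw, s = s' / (w.c : ℝ≥0∞) + (w.d : ℝ≥0∞) / w.c) ∧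
    (w.c ≠ 1 → (w.d : ℝ≥0∞) / w.c ∈ contacts φ (image κ w γ Aw) (image κ w γ Bw)) := by
  obtain ⟨γ₁, ψ', hγ₁, hψ', h0, h1⟩ := exists_adapted_coordinates w hγ
  rw [contacts_eq_of_firstAxis_eq hφ, contacts_eq_of_firstAxis_eq (hψ.trans hψ'.symm)]
  have lift : ∀ {D : Ideal FormalPlane} {n : ℕ+} {q : FormalPlane →ₐ[ℂ] PowerSeries ℂ},
      q (ψ' (MvPowerSeries.X 0)) = X ^ (n : ℕ) → D ≤ RingHom.ker q →
      toricLift w γ₁ n (q (ψ' (MvPowerSeries.X 1))) ∈ roots κ (image κ w γ D) := by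
    intro D n q hq hD
    obtain ⟨h2, h3⟩ := arc_pullback (κ := κ) h0 h1 hq
    exact mem_roots_iff.2 ⟨n * w.denom, q.comp (pullback κ w γ), h2, Ideal.comap_mono hD,
      by rw [toricLift, ← h3]; rfl⟩
  obtain ⟨η, hη⟩ := roots_nonempty (φ := ψ') hAw (by rwa [hψ'])
  obtain ⟨η', hη'⟩ := roots_nonempty (φ := ψ') hBw (by rwa [hψ'])
  obtain ⟨n, q, q', hq, hq', hqA, hqB, rfl, rfl⟩ := exists_common_denominator hη hη'
  have hζ : ∀ q : FormalPlane →ₐ[ℂ] PowerSeries ℂ,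
      constantCoeff (q (ψ' (MvPowerSeries.X 1))) = 0 := fun q =>
    constantCoeff_algHom_X (q.comp (ψ' : FormalPlane →ₐ[ℂ] FormalPlane)) 1
  refine ⟨?_, ?_, fun hc => ?_⟩
  · rintro _ ⟨ξ, hξ, ξ', hξ', rfl⟩
    obtain ⟨n, q, q', hq, hq', hqA, hqB, rfl, rfl⟩ := exists_common_denominator hξ hξ'
    refine ⟨_, lift hq hqA, _, lift hq' hqB, ?_⟩
    have := orderX_toricLift_sub_twist w γ₁ n (q (ψ' (MvPowerSeries.X 1)))
      (q' (ψ' (MvPowerSeries.X 1))) 0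
    rw [mul_zero, twist_zero, twist_zero] at this
    exact this.symm
  · rintro _ ⟨ξ, hξ, ξ', hξ', rfl⟩
    obtain ⟨k, rfl⟩ := exists_eq_twist (isBranch_image κ w hγ hAw hAE).1 (lift hq hqA) hξ
    obtain ⟨k', rfl⟩ := exists_eq_twist (isBranch_image κ w hγ hBw hBE).1 (lift hq' hqB) hξ'
    rw [← orderX_twist (-k), twist_sub, twist_twist, twist_twist, neg_add_cancel, twist_zero]
    by_cases hl : (w.c : ℤ) ∣ -k + k'
    · obtain ⟨m, hm⟩ := hl
      rw [hm, orderX_toricLift_sub_twist]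
      exact Or.inr ⟨_, ⟨_, hη, _, twist_mem_roots hη' m, rfl⟩, rfl⟩
    · exact Or.inl (orderX_toricLift_sub_twist_of_not_dvd w hγ₁ n (hζ q) (hζ q') hl)
  · refine ⟨_, lift hq hqA, _, twist_mem_roots (lift hq' hqB) 1, ?_⟩
    rw [orderX_toricLift_sub_twist_of_not_dvd w hγ₁ n (hζ q) (hζ q')]
    intro h
    exact hc (by exact_mod_cast Int.eq_one_of_dvd_one (by positivity) h)

/-- Distinct branches have distinct images. -/
theorem image_injective (κ : Coordinates R) (w : Weight) {γ : ℂ} (hγ : γ ≠ 0)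
    {Aw Bw : Ideal FormalPlane} (hAw : IsBranch Aw) (hAE : Aw ≠ exceptional)
    (hBw : IsBranch Bw) (hBE : Bw ≠ exceptional) (h : image κ w γ Aw = image κ w γ Bw) :
    Aw = Bw := by
  obtain ⟨γ₁, ψ, -, hψ, -, -⟩ := exists_adapted_coordinates w hγ
  have hc : (w.c : ℝ≥0∞) ≠ 0 := by exact_mod_cast w.c_pos.ne'
  have hd : (w.d : ℝ≥0∞) / w.c ≠ ⊤ := ENNReal.div_ne_top (ENNReal.natCast_ne_top _) hc
  obtain ⟨ξ, hξ⟩ := roots_nonempty (isBranch_image κ w hγ hAw hAE).1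
    (isBranch_image κ w hγ hAw hAE).2
  -- equal images have an infinite contact, which must come from a common root at `o_w`
  have htop : ⊤ ∈ contacts κ (image κ w γ Aw) (image κ w γ Bw) :=
    ⟨ξ, hξ, ξ, h ▸ hξ, by rw [sub_self, orderX_zero]⟩
  rcases (contacts_image κ w hγ rfl hψ hAw hAE hBw hBE).2.1 _ htop with h1 | ⟨s, hs, h1⟩
  · exact absurd h1.symm hd
  · have hs' : s = ⊤ := by
      by_contra hne
      exact ENNReal.add_ne_top.2 ⟨ENNReal.div_ne_top hne hc, hd⟩ h1.symm
    obtain ⟨η, hη, η', hη', h2⟩ := hs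
    rw [hs', eq_comm, orderX_eq_top, sub_eq_zero] at h2
    obtain ⟨n, q, q', hq, hq', hqA, hqB, h3, h4⟩ := exists_common_denominator hη hη'
    rw [h3, h4] at h2
    have h5 : q.comp (ψ : FormalPlane →ₐ[ℂ] FormalPlane) =
        q'.comp (ψ : FormalPlane →ₐ[ℂ] FormalPlane) := by
      apply arc_ext
      intro i
      fin_cases i
      · exact hq.trans hq'.symm
      · exact puiseux_injective n h2
    have h6 : q = q' := by
      ext1 f
      have := DFunLike.congr_fun h5 (ψ.symm f)
      simpa using this
    rw [← ker_eq_of_isBranch ψ hAw n.ne_zero hq hqA, h6, ker_eq_of_isBranch ψ hBw n.ne_zero hq' hqB]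

end Image

/-! ### Exponents, indices and contact complexities of the image -/

namespace Weight

variable (w : Weight)

theorem coe_c_ne_zero : (w.c : ℝ≥0∞) ≠ 0 := by exact_mod_cast w.c_pos.ne'

theorem coe_c_ne_top : (w.c : ℝ≥0∞) ≠ ⊤ := ENNReal.natCast_ne_top _

theorem slope_ne_top : (w.d : ℝ≥0∞) / w.c ≠ ⊤ :=
  ENNReal.div_ne_top (ENNReal.natCast_ne_top _) w.coe_c_ne_zero

/-- The effect `s ↦ s / c + d / c` of the toric morphism on exponents. -/
def exponentMap (s : ℝ≥0∞) : ℝ≥0∞ := s / (w.c : ℝ≥0∞) + (w.d : ℝ≥0∞) / w.c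

theorem exponentMap_strictMono : StrictMono w.exponentMap := fun _ _ h =>
  ENNReal.add_lt_add_right w.slope_ne_top
    ((ENNReal.div_lt_div_iff_left w.coe_c_ne_zero w.coe_c_ne_top).2 h)

theorem slope_le_exponentMap (s : ℝ≥0∞) : (w.d : ℝ≥0∞) / w.c ≤ w.exponentMap s :=
  le_add_self

theorem exponentMap_zero : w.exponentMap 0 = (w.d : ℝ≥0∞) / w.c := by
  simp [exponentMap]

theorem exponentMap_ofReal {q : ℝ} (hq : 0 ≤ q) :
    w.exponentMap (ENNReal.ofReal q) = ENNReal.ofReal ((q + w.d) / w.c) := by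
  have hc : (0 : ℝ) < w.c := by exact_mod_cast w.c_pos
  rw [exponentMap, ← ENNReal.add_div, ENNReal.ofReal_div_of_pos hc,
    ENNReal.ofReal_add hq (Nat.cast_nonneg _), ENNReal.ofReal_natCast, ENNReal.ofReal_natCast]

theorem slope_eq_ofReal : (w.d : ℝ≥0∞) / w.c = ENNReal.ofReal ((w.d : ℝ) / w.c) := by
  rw [← exponentMap_zero, ← ENNReal.ofReal_zero, exponentMap_ofReal _ le_rfl, zero_add]

end Weight

section Image

variable {R : Type*} [CommRing R] [Algebra ℂ R] {κ : Coordinates R} {w : Weight} {γ : ℂ}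
  {φ : Coordinates R} {ψ : Coordinates FormalPlane} {Aw Bw : Ideal FormalPlane}

/-- The order of coincidence is the largest contact, and the additional contact `d / c` of the
images is not larger than the others. -/
theorem coincidence_image (hγ : γ ≠ 0) (hφ : firstAxis φ = firstAxis κ)
    (hψ : firstAxis ψ = exceptional) (hAw : IsBranch Aw) (hAE : Aw ≠ exceptional)
    (hBw : IsBranch Bw) (hBE : Bw ≠ exceptional) :
    coincidence φ (image κ w γ Aw) (image κ w γ Bw) = w.exponentMap (coincidence ψ Aw Bw) := by
  obtain ⟨h1, h2, -⟩ := contacts_image κ w hγ hφ hψ hAw hAE hBw hBE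
  rw [coincidence_eq_sSup, coincidence_eq_sSup]
  apply le_antisymm
  · refine sSup_le fun s hs => ?_
    rcases h2 s hs with rfl | ⟨s', hs', rfl⟩
    · exact w.slope_le_exponentMap _
    · exact w.exponentMap_strictMono.monotone (le_sSup hs')
  · set K := sSup (contacts φ (image κ w γ Aw) (image κ w γ Bw))
    have hle : ∀ s ∈ contacts ψ Aw Bw, w.exponentMap s ≤ K := fun s hs => le_sSup (h1 s hs)
    obtain ⟨η, hη⟩ := roots_nonempty hAw (hψ ▸ hAE)
    obtain ⟨η', hη'⟩ := roots_nonempty hBw (hψ ▸ hBE)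
    have hK : (w.d : ℝ≥0∞) / w.c ≤ K :=
      (w.slope_le_exponentMap _).trans (hle _ ⟨η, hη, η', hη', rfl⟩)
    -- the supremum need not be known to be attained: the map `s ↦ s / c + d / c` is inverted
    have h3 : sSup (contacts ψ Aw Bw) ≤ (K - (w.d : ℝ≥0∞) / w.c) * w.c := by
      refine sSup_le fun s hs => ?_
      rw [← ENNReal.div_le_iff w.coe_c_ne_zero w.coe_c_ne_top]
      exact ENNReal.le_sub_of_add_le_right w.slope_ne_top (hle s hs)
    rw [← ENNReal.div_le_iff w.coe_c_ne_zero w.coe_c_ne_top] at h3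
    exact (add_le_add_left h3 _).trans (tsub_add_cancel_of_le hK).le

/-- The characteristic exponents of the image of a branch are those of the branch, transformed, and
`d / c`, the latter unless `c = 1`. -/
theorem mem_charExponents_image (hγ : γ ≠ 0) (hφ : firstAxis φ = firstAxis κ)
    (hψ : firstAxis ψ = exceptional) (hAw : IsBranch Aw) (hAE : Aw ≠ exceptional) :
    (∀ q ∈ charExponents ψ Aw, (q + w.d) / w.c ∈ charExponents φ (image κ w γ Aw)) ∧
    (∀ q ∈ charExponents φ (image κ w γ Aw), q = (w.d : ℚ) / w.c ∨
      ∃ q' ∈ charExponents ψ Aw, q = (q' + w.d) / w.c) ∧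
    (w.c ≠ 1 → (w.d : ℚ) / w.c ∈ charExponents φ (image κ w γ Aw)) := by
  obtain ⟨h1, h2, h3⟩ := contacts_image κ w hγ hφ hψ hAw hAE hAw hAE
  have cast1 : ∀ {q : ℚ}, 0 ≤ q → ENNReal.ofReal (((q + w.d) / w.c : ℚ) : ℝ) =
      w.exponentMap (ENNReal.ofReal (q : ℝ)) := by
    intro q hq
    rw [w.exponentMap_ofReal (by exact_mod_cast hq)]
    push_cast
    rfl
  have cast2 : ENNReal.ofReal (((w.d : ℚ) / w.c : ℚ) : ℝ) = (w.d : ℝ≥0∞) / w.c := by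
    rw [w.slope_eq_ofReal]
    push_cast
    rfl
  refine ⟨fun q hq => ?_, fun q hq => ?_, fun hc => ?_⟩
  · rw [mem_charExponents_iff] at hq ⊢
    refine ⟨div_nonneg (add_nonneg hq.1 (Nat.cast_nonneg _)) (Nat.cast_nonneg _), ?_⟩
    rw [cast1 hq.1]
    exact h1 _ hq.2
  · rw [mem_charExponents_iff] at hq
    rcases h2 _ hq.2 with h | ⟨s, hs, h⟩
    · left
      rw [← cast2] at h
      exact ofReal_rat_injective hq.1 (by positivity) h
    · right
      have hs' : s ≠ ⊤ := by
        rintro rfl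
        rw [ENNReal.top_div_of_ne_top w.coe_c_ne_top, top_add] at h
        exact ENNReal.ofReal_ne_top h
      obtain ⟨ξ, hξ, ξ', hξ', rfl⟩ := id hs
      have hne : ξ - ξ' ≠ 0 := fun h0 => hs' (orderX_eq_top.2 h0)
      have hnn := order_sub_nonneg hξ hξ'
      rw [orderX_of_ne_zero hne] at hs h
      refine ⟨_, mem_charExponents_iff.2 ⟨hnn, hs⟩, ?_⟩
      refine ofReal_rat_injective hq.1 (by positivity) (h.trans (cast1 hnn).symm)
  · rw [mem_charExponents_iff, cast2]
    exact ⟨by positivity, h3 hc⟩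

theorem indexOn_image_of_le (hγ : γ ≠ 0) (hφ : firstAxis φ = firstAxis κ)
    (hψ : firstAxis ψ = exceptional) (hAw : IsBranch Aw) (hAE : Aw ≠ exceptional) {s : ℝ≥0∞}
    (hs : s ≤ (w.d : ℝ≥0∞) / w.c) : indexOn φ (image κ w γ Aw) s = 1 := by
  apply indexOn_eq_one
  intro q hq
  refine hs.trans ?_
  rcases (contacts_image κ w hγ hφ hψ hAw hAE hAw hAE).2.1 _ (mem_charExponents_iff.1 hq).2 with
    h | ⟨s', -, h⟩
  · exact h.ge
  · rw [h]
    exact w.slope_le_exponentMap s'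

/-- The characteristic exponent `d / c` has denominator `c`, and it accounts for the factor `c`. -/
theorem indexOn_image (hγ : γ ≠ 0) (hφ : firstAxis φ = firstAxis κ)
    (hψ : firstAxis ψ = exceptional) (hAw : IsBranch Aw) (hAE : Aw ≠ exceptional) {s : ℝ≥0∞}
    (hs : 0 < s) :
    indexOn φ (image κ w γ Aw) (w.exponentMap s) = w.c * indexOn ψ Aw s := by
  obtain ⟨h1, h2, h3⟩ := mem_charExponents_image (κ := κ) (w := w) hγ hφ hψ hAw hAE
  have hc : (w.c : ℚ) ≠ 0 := by exact_mod_cast w.c_pos.ne'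
  have hlt : ∀ q ∈ charExponents ψ Aw, (ENNReal.ofReal (((q + w.d) / w.c : ℚ) : ℝ) <
      w.exponentMap s ↔ ENNReal.ofReal (q : ℝ) < s) := by
    intro q hq
    have h : ENNReal.ofReal (((q + w.d) / w.c : ℚ) : ℝ) =
        w.exponentMap (ENNReal.ofReal (q : ℝ)) := by
      rw [w.exponentMap_ofReal (by exact_mod_cast (mem_charExponents_iff.1 hq).1)]
      push_cast
      rfl
    rw [h, w.exponentMap_strictMono.lt_iff_lt]
  have hlt0 : ENNReal.ofReal (((w.d : ℚ) / w.c : ℚ) : ℝ) < w.exponentMap s := by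
    have := w.exponentMap_strictMono hs
    rw [w.exponentMap_zero, w.slope_eq_ofReal] at this
    push_cast
    exact this
  -- the common denominators of the exponents of the image are the multiples by `c` of those of
  -- the exponents of the branch
  have key : ∀ N : ℕ, (0 < N ∧ ∀ q ∈ charExponents φ (image κ w γ Aw),
      ENNReal.ofReal (q : ℝ) < w.exponentMap s → q.den ∣ N) ↔
      ∃ M : ℕ, (0 < M ∧ ∀ q ∈ charExponents ψ Aw, ENNReal.ofReal (q : ℝ) < s → q.den ∣ M) ∧
        N = w.c * M := by
    intro N
    constructor
    · rintro ⟨hN, h⟩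
      have hcN : w.c ∣ N := by
        by_cases hc1 : w.c = 1
        · rw [hc1]; exact one_dvd N
        · obtain ⟨z, hz⟩ := den_dvd_iff.1 (h _ (h3 hc1) hlt0)
          rw [div_mul_eq_mul_div, div_eq_iff hc] at hz
          have hz' : (w.c : ℤ) ∣ w.d * N := ⟨z, by rw [mul_comm (w.c : ℤ)]; exact_mod_cast hz⟩
          exact w.coprime.dvd_of_dvd_mul_left (by exact_mod_cast hz')
      obtain ⟨M, rfl⟩ := hcN
      refine ⟨M, ⟨Nat.pos_of_mul_pos_left hN, fun q hq hqs => ?_⟩, rfl⟩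
      obtain ⟨z, hz⟩ := den_dvd_iff.1 (h _ (h1 q hq) ((hlt q hq).2 hqs))
      rw [den_dvd_iff]
      refine ⟨z - w.d * M, ?_⟩
      push_cast at hz ⊢
      rw [← hz]
      field_simp
      ring
    · rintro ⟨M, ⟨hM, h⟩, rfl⟩
      refine ⟨Nat.mul_pos w.c_pos hM, fun q hq hqs => ?_⟩
      rw [den_dvd_iff]
      rcases h2 q hq with rfl | ⟨q', hq', rfl⟩
      · refine ⟨w.d * M, ?_⟩
        push_cast
        field_simp
      · obtain ⟨z, hz⟩ := den_dvd_iff.1 (h q' hq' ((hlt q' hq').1 hqs))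
        refine ⟨z + w.d * M, ?_⟩
        push_cast
        rw [← hz]
        field_simp
  apply le_antisymm
  · exact Nat.sInf_le ((key _).2 ⟨_, indexOn_spec hAw s, rfl⟩)
  · obtain ⟨M, hM, hM'⟩ :=
      (key _).1 (indexOn_spec (isBranch_image κ w hγ hAw hAE).1 (w.exponentMap s))
    rw [hM']
    exact Nat.mul_le_mul_left _ (Nat.sInf_le hM)

theorem contactOn_zero {A : Ideal R} : contactOn φ A 0 = 0 := by
  have : {t : ℝ | 0 < t ∧ ENNReal.ofReal t < 0} = ∅ := by
    ext t; simp
  rw [contactOn, this, MeasureTheory.Measure.restrict_empty, MeasureTheory.lintegral_zero_measure]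

/-- On the part of the segment beyond `d / c`, one factor `1 / c` comes from the change of variable
and the other from the index; the part before `d / c` has index one and contributes `d / c`. -/
theorem contactOn_image (hγ : γ ≠ 0) (hφ : firstAxis φ = firstAxis κ)
    (hψ : firstAxis ψ = exceptional) (hAw : IsBranch Aw) (hAE : Aw ≠ exceptional) (s : ℝ≥0∞) :
    contactOn φ (image κ w γ Aw) (w.exponentMap s) =
      contactOn ψ Aw s / (w.c : ℝ≥0∞) ^ 2 + (w.d : ℝ≥0∞) / w.c := by
  have hc : (0 : ℝ) < w.c := by exact_mod_cast w.c_pos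
  have hdc : (0 : ℝ) < (w.d : ℝ) / w.c := div_pos (by exact_mod_cast w.d_pos) hc
  -- below the exponent `d / c` the index is one
  have hroot : ∀ D ⊆ Set.Ioc (0 : ℝ) (w.d / w.c), MeasurableSet D →
      ∫⁻ t in D, ((indexOn φ (image κ w γ Aw) (ENNReal.ofReal t) : ℕ) : ℝ≥0∞)⁻¹ =
        MeasureTheory.volume D := by
    intro D hD hDm
    rw [← MeasureTheory.setLIntegral_one]
    apply MeasureTheory.setLIntegral_congr_fun hDm
    intro t ht
    simp only
    rw [indexOn_image_of_le hγ hφ hψ hAw hAE, Nat.cast_one, inv_one]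
    rw [w.slope_eq_ofReal]
    exact ENNReal.ofReal_le_ofReal (hD ht).2
  rcases eq_or_ne s 0 with rfl | hs
  · rw [contactOn_zero, ENNReal.zero_div, zero_add, w.exponentMap_zero, contactOn]
    have hset : {t : ℝ | 0 < t ∧ ENNReal.ofReal t < (w.d : ℝ≥0∞) / w.c} =
        Set.Ioo (0 : ℝ) ((w.d : ℝ) / w.c) := by
      ext t
      rw [Set.mem_ofPred_eq, w.slope_eq_ofReal, ENNReal.ofReal_lt_ofReal_iff hdc, Set.mem_Ioo]
    rw [hset, hroot _ Set.Ioo_subset_Ioc_self measurableSet_Ioo, Real.volume_Ioo, sub_zero,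
      w.slope_eq_ofReal]
  · set f : ℝ → ℝ := fun t => (t + w.d) / w.c with hf
    have hset : {t : ℝ | 0 < t ∧ ENNReal.ofReal t < w.exponentMap s} =
        Set.Ioc 0 ((w.d : ℝ) / w.c) ∪ f '' {t : ℝ | 0 < t ∧ ENNReal.ofReal t < s} := by
      ext t
      constructor
      · rintro ⟨ht, hts⟩
        by_cases htd : t ≤ w.d / w.c
        · exact Or.inl ⟨ht, htd⟩
        · have hpos : 0 < t * w.c - w.d := by
            rw [not_le, div_lt_iff₀ hc] at htd
            linarith
          have hft : f (t * w.c - w.d) = t := by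
            rw [hf]
            field_simp
            ring
          refine Or.inr ⟨_, ⟨hpos, ?_⟩, hft⟩
          rw [← w.exponentMap_strictMono.lt_iff_lt, w.exponentMap_ofReal hpos.le]
          rw [hf] at hft
          simp only at hft
          rwa [hft]
      · rintro (⟨ht, htd⟩ | ⟨t, ⟨ht, hts⟩, rfl⟩)
        · refine ⟨ht, (ENNReal.ofReal_le_ofReal htd).trans_lt ?_⟩
          rw [← w.slope_eq_ofReal, ← w.exponentMap_zero]
          exact w.exponentMap_strictMono (pos_iff_ne_zero.2 hs)
        · refine ⟨by positivity, ?_⟩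
          rw [hf]
          simp only
          rw [← w.exponentMap_ofReal ht.le]
          exact w.exponentMap_strictMono hts
    have hinj : Function.Injective f := by
      intro a b hab
      simpa [hf, hc.ne'] using hab
    have hderiv : ∀ t ∈ {t : ℝ | 0 < t ∧ ENNReal.ofReal t < s},
        HasDerivWithinAt f (1 / w.c) {t : ℝ | 0 < t ∧ ENNReal.ofReal t < s} t := fun t _ =>
      (((hasDerivAt_id t).add_const (w.d : ℝ)).div_const (w.c : ℝ)).hasDerivWithinAt
    have hmeas := measurableSet_segment s
    have hdisj : Disjoint (Set.Ioc 0 ((w.d : ℝ) / w.c))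
        (f '' {t : ℝ | 0 < t ∧ ENNReal.ofReal t < s}) := by
      rw [Set.disjoint_left]
      rintro _ ⟨-, ht⟩ ⟨t, ⟨ht0, -⟩, rfl⟩
      rw [hf] at ht
      simp only at ht
      rw [div_le_div_iff_of_pos_right hc] at ht
      linarith
    rw [contactOn, hset, MeasureTheory.lintegral_union (by
        rw [← Set.union_sdiff_cancel_left hdisj.le_bot, ← hset]
        exact (measurableSet_segment _).diff measurableSet_Ioc) hdisj,
      hroot _ le_rfl measurableSet_Ioc,
      Real.volume_Ioc, sub_zero, ← w.slope_eq_ofReal,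
      MeasureTheory.lintegral_image_eq_lintegral_abs_deriv_mul hmeas hderiv hinj.injOn, add_comm]
    congr 1
    have hpt : ∀ t ∈ {t : ℝ | 0 < t ∧ ENNReal.ofReal t < s},
        ENNReal.ofReal |1 / (w.c : ℝ)| *
          ((indexOn φ (image κ w γ Aw) (ENNReal.ofReal (f t)) : ℕ) : ℝ≥0∞)⁻¹ =
        ((w.c : ℝ≥0∞) ^ 2)⁻¹ * ((indexOn ψ Aw (ENNReal.ofReal t) : ℕ) : ℝ≥0∞)⁻¹ := by
      rintro t ⟨ht, -⟩
      rw [hf]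
      simp only
      rw [← w.exponentMap_ofReal ht.le,
        indexOn_image hγ hφ hψ hAw hAE (ENNReal.ofReal_pos.2 ht), abs_of_pos (by positivity),
        one_div, ENNReal.ofReal_inv_of_pos hc, ENNReal.ofReal_natCast, Nat.cast_mul,
        ENNReal.mul_inv (Or.inl w.coe_c_ne_zero) (Or.inl w.coe_c_ne_top), ← mul_assoc, sq,
        ENNReal.mul_inv (Or.inl w.coe_c_ne_zero) (Or.inl w.coe_c_ne_top)]
    rw [MeasureTheory.setLIntegral_congr_fun hmeas hpt,
      MeasureTheory.lintegral_const_mul' _ _ (ENNReal.inv_ne_top.2 (pow_ne_zero _ w.coe_c_ne_zero)),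
      ENNReal.div_eq_inv_mul, contactOn]

end Image

/-! ### The image of a reduced curve and the natural embedding -/

section ReducedImage

variable {R : Type*} [CommRing R] [Algebra ℂ R] (κ : Coordinates R) (w : Weight) {γ : ℂ}

theorem branch_ne_exceptional {Cw Aw : Ideal FormalPlane} (hE : ¬ Cw ≤ exceptional)
    (h : Cw ≤ Aw) : Aw ≠ exceptional := by
  rintro rfl
  exact hE h

/-- The image of a curve without the exceptional component is defined by one equation: it is the
intersection of the images of its branches. -/
theorem exists_comap_eq_span [IsDomain R] [UniqueFactorizationMonoid R] (hγ : γ ≠ 0)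
    (f : FormalPlane) (hf0 : f ≠ 0) (hf : Squarefree f) (hE : ¬ MvPowerSeries.X 0 ∣ f) :
    ∃ h : R, h ≠ 0 ∧ (Ideal.span {f}).comap (pullback κ w γ) = Ideal.span {h} := by
  induction f using WfDvdMonoid.induction_on_irreducible with
  | zero => exact absurd rfl hf0
  | unit u hu =>
    exact ⟨1, one_ne_zero, by
      rw [Ideal.span_singleton_eq_top.2 hu, Ideal.comap_top, Ideal.span_singleton_one]⟩
  | mul a i ha hi ih =>
    obtain ⟨h₁, h₁0, e₁⟩ := ih ha (hf.of_mul_right) (fun h => hE (h.mul_left i))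
    have hAE : Ideal.span {i} ≠ exceptional := by
      intro h
      apply hE
      refine dvd_mul_of_dvd_left ?_ a
      rw [exceptional, Ideal.span_singleton_eq_span_singleton] at h
      exact h.symm.dvd
    obtain ⟨⟨h₂, h₂i, e₂⟩, -⟩ := isBranch_image κ w hγ ⟨i, hi, rfl⟩ hAE
    rw [image] at e₂
    let _ := UniqueFactorizationMonoid.toGCDMonoid R
    refine ⟨lcm h₂ h₁, lcm_ne_zero_iff.2 ⟨h₂i.ne_zero, h₁0⟩, ?_⟩
    have hinf : Ideal.span {i * a} = Ideal.span {i} ⊓ Ideal.span {a} := by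
      ext g
      rw [Ideal.mem_inf, Ideal.mem_span_singleton, Ideal.mem_span_singleton,
        Ideal.mem_span_singleton]
      refine ⟨fun h => ⟨(dvd_mul_right i a).trans h, (dvd_mul_left a i).trans h⟩, ?_⟩
      rintro ⟨h, b, rfl⟩
      have hia : ¬ i ∣ a := fun h => hi.not_isUnit (hf i (mul_dvd_mul_left i h))
      rw [mul_comm i a]
      exact mul_dvd_mul_left a ((hi.prime.dvd_or_dvd h).resolve_left hia)
    rw [hinf, Ideal.comap_inf, e₁, e₂]
    ext g
    rw [Ideal.mem_inf, Ideal.mem_span_singleton, Ideal.mem_span_singleton,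
      Ideal.mem_span_singleton, lcm_dvd_iff]

/-- The image is principal and its ideal is radical, hence generated by a square-free element. -/
theorem isReducedCurve_image (hγ : γ ≠ 0) {Cw : Ideal FormalPlane} (hCw : IsReducedCurve Cw)
    (hE : ¬ Cw ≤ exceptional) : IsReducedCurve (image κ w γ Cw) := by
  have : IsDomain R := κ.symm.toMulEquiv.isDomain _
  have : UniqueFactorizationMonoid R :=
    κ.toMulEquiv.uniqueFactorizationMonoid inferInstance
  obtain ⟨f, hf0, hfu, hf, rfl⟩ := hCw
  obtain ⟨h, h0, e⟩ := exists_comap_eq_span κ w hγ f hf0 hf (fun h => hE (by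
    rw [exceptional, Ideal.span_singleton_le_span_singleton]
    exact h))
  refine ⟨h, h0, fun hu => ?_, ?_, e⟩
  · rw [Ideal.span_singleton_eq_top.2 hu, Ideal.comap_eq_top_iff, Ideal.span_singleton_eq_top] at e
    exact hfu e
  · apply IsRadical.squarefree h0
    rw [isRadical_iff_span_singleton, ← e]
    exact Ideal.IsRadical.comap _ ((isRadical_iff_span_singleton).1 hf.isRadical)

end ReducedImage

section Embedding

variable {R : Type*} [CommRing R] [Algebra ℂ R] (κ : Coordinates R) (w : Weight) {γ : ℂ}
  {φ : Coordinates R} {ψ : Coordinates FormalPlane} {Cw : Ideal FormalPlane} {C : Ideal R}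

/-- The image of a branch of a curve, as a branch of a curve which contains the image. -/
def imageBranch (hγ : γ ≠ 0) (hE : ¬ Cw ≤ exceptional) (hC : C ≤ image κ w γ Cw)
    (Aw : Branch Cw) : Branch C :=
  ⟨image κ w γ Aw.1, (isBranch_image κ w hγ Aw.2.1 (branch_ne_exceptional hE Aw.2.2)).1,
    hC.trans (Ideal.comap_mono Aw.2.2)⟩

/-- The image of a point of the segment of a branch: it lies on the segment of the image of that
branch, and its exponent is given by `Weight.exponentMap`. -/
def imagePoint (hγ : γ ≠ 0) (hE : ¬ Cw ≤ exceptional) (hC : C ≤ image κ w γ Cw)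
    (hφ : firstAxis φ = firstAxis κ) (Q : SegmentPoint ψ Cw) : SegmentPoint φ C where
  branch := imageBranch κ w hγ hE hC Q.branch
  exponent := w.exponentMap Q.exponent
  exponent_eq_zero h := absurd (h.trans hφ)
    (isBranch_image κ w hγ Q.branch.2.1 (branch_ne_exceptional hE Q.branch.2.2)).2

theorem coincidence_imageBranch (hγ : γ ≠ 0) (hE : ¬ Cw ≤ exceptional)
    (hC : C ≤ image κ w γ Cw) (hφ : firstAxis φ = firstAxis κ)
    (hψ : firstAxis ψ = exceptional) (Aw Bw : Branch Cw) :
    coincidence φ (imageBranch κ w hγ hE hC Aw).1 (imageBranch κ w hγ hE hC Bw).1 =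
      w.exponentMap (coincidence ψ Aw.1 Bw.1) :=
  coincidence_image hγ hφ hψ Aw.2.1 (branch_ne_exceptional hE Aw.2.2) Bw.2.1
    (branch_ne_exceptional hE Bw.2.2)

theorem identified_imagePoint_iff (hγ : γ ≠ 0) (hE : ¬ Cw ≤ exceptional)
    (hC : C ≤ image κ w γ Cw) (hφ : firstAxis φ = firstAxis κ)
    (hψ : firstAxis ψ = exceptional) (p q : SegmentPoint ψ Cw) :
    Identified φ C (imagePoint κ w hγ hE hC hφ p) (imagePoint κ w hγ hE hC hφ q) ↔
      Identified ψ Cw p q := by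
  have h := coincidence_imageBranch κ w hγ hE hC hφ hψ p.branch q.branch
  refine and_congr w.exponentMap_strictMono.injective.eq_iff ?_
  refine (h ▸ Iff.rfl : _ ↔ w.exponentMap p.exponent ≤ _).trans
    w.exponentMap_strictMono.le_iff_le

theorem imagePoint_injective (hγ : γ ≠ 0) (hE : ¬ Cw ≤ exceptional)
    (hC : C ≤ image κ w γ Cw) (hφ : firstAxis φ = firstAxis κ) :
    Function.Injective (imagePoint κ w hγ hE hC hφ (ψ := ψ)) := by
  intro p q h
  have h1 := congrArg (fun P : SegmentPoint φ C => P.branch.1) h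
  have h2 := congrArg SegmentPoint.exponent h
  exact SegmentPoint.ext
    (Subtype.ext (image_injective κ w hγ p.branch.2.1 (branch_ne_exceptional hE p.branch.2.2)
      q.branch.2.1 (branch_ne_exceptional hE q.branch.2.2) h1))
    (w.exponentMap_strictMono.injective h2)

theorem contact_imagePoint (hγ : γ ≠ 0) (hE : ¬ Cw ≤ exceptional)
    (hC : C ≤ image κ w γ Cw) (hφ : firstAxis φ = firstAxis κ)
    (hψ : firstAxis ψ = exceptional) (Q : SegmentPoint ψ Cw) :
    (Tree.mk (imagePoint κ w hγ hE hC hφ Q)).contact =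
      (Tree.mk Q).contact / (w.c : ℝ≥0∞) ^ 2 + (w.d : ℝ≥0∞) / w.c := by
  rw [Tree.contact_mk, Tree.contact_mk]
  exact contactOn_image hγ hφ hψ Q.branch.2.1 (branch_ne_exceptional hE Q.branch.2.2) _

/-- The contact complexity is a strictly increasing function of the exponent on each segment, so
that a natural embedding is determined by its defining property. -/
theorem IsNaturalEmbedding.apply_mk (hγ : γ ≠ 0) (hE : ¬ Cw ≤ exceptional)
    (hC : C ≤ image κ w γ Cw) (hφ : firstAxis φ = firstAxis κ)
    (hψ : firstAxis ψ = exceptional) {ι : Tree ψ Cw → Tree φ C}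
    (hι : IsNaturalEmbedding κ w γ φ ψ C Cw ι) (Q : SegmentPoint ψ Cw) :
    ι (Tree.mk Q) = Tree.mk (imagePoint κ w hγ hE hC hφ Q) := by
  obtain ⟨A, hA, h⟩ := hι Q.branch
  obtain ⟨Q', hQ', hmk, hc⟩ := h Q rfl
  have hb : Q'.branch = (imagePoint κ w hγ hE hC hφ Q).branch := Subtype.ext (by rw [hQ', hA]; rfl)
  rw [← contact_imagePoint κ w hγ hE hC hφ hψ Q, Tree.contact_mk, Tree.contact_mk, hb] at hc
  rw [hmk]
  exact congrArg Tree.mk (SegmentPoint.ext hb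
    (contactOn_strictMono (imagePoint κ w hγ hE hC hφ Q).branch.2.1 |>.injective hc))

end Embedding

end EggersWall
end

theorem proposition5p20 {R : Type*} [CommRing R] [Algebra ℂ R]
    (κ : EggersWall.Coordinates R) (w : EggersWall.Weight) (γ : ℂ) (hγ : γ ≠ 0)
    (φ : EggersWall.Coordinates R)
    (hφ : EggersWall.firstAxis φ = EggersWall.firstAxis κ)
    (ψ : EggersWall.Coordinates EggersWall.FormalPlane)
    (hψ : EggersWall.firstAxis ψ = EggersWall.exceptional)
    (Cw : Ideal EggersWall.FormalPlane) (hCw : EggersWall.IsReducedCurve Cw)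
    (hE : ¬ Cw ≤ EggersWall.exceptional) :
    EggersWall.IsReducedCurve (EggersWall.image κ w γ Cw) ∧
    ∀ C : Ideal R, EggersWall.IsReducedCurve C → C ≤ EggersWall.image κ w γ Cw →
      (∃! ι : EggersWall.Tree ψ Cw → EggersWall.Tree φ C,
        EggersWall.IsNaturalEmbedding κ w γ φ ψ C Cw ι) ∧
      (∀ ι : EggersWall.Tree ψ Cw → EggersWall.Tree φ C,
        EggersWall.IsNaturalEmbedding κ w γ φ ψ C Cw ι →
        Function.Injective ι ∧
        (∀ Q : EggersWall.Tree ψ Cw, Q.exponent ≠ 0 → (ι Q).index = w.c * Q.index) ∧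
        (∀ Q : EggersWall.Tree ψ Cw, Q.exponent = 0 → (ι Q).index = 1 ∧ Q.index = 1) ∧
        (∀ Q : EggersWall.Tree ψ Cw,
          (ι Q).exponent = Q.exponent / (w.c : ENNReal) + (w.d : ENNReal) / w.c)) ∧
      (∀ Aw Bw : EggersWall.Branch Cw, Aw ≠ Bw →
        EggersWall.coincidence φ (EggersWall.image κ w γ Aw.1) (EggersWall.image κ w γ Bw.1)
          = (w.d : ENNReal) / w.c + EggersWall.coincidence ψ Aw.1 Bw.1 / (w.c : ENNReal)) := by
  open EggersWall in
  refine ⟨isReducedCurve_image κ w hγ hCw hE, fun C _ hC => ⟨?_, ?_, ?_⟩⟩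
  · refine ⟨Quot.lift (fun Q => Tree.mk (imagePoint κ w hγ hE hC hφ Q)) fun p q h =>
      Tree.mk_eq_mk_iff.2 (Or.inr ((identified_imagePoint_iff κ w hγ hE hC hφ hψ p q).2 h)),
      fun Aw => ⟨imageBranch κ w hγ hE hC Aw, rfl, ?_⟩, fun ι hι => ?_⟩
    · rintro Q rfl
      exact ⟨imagePoint κ w hγ hE hC hφ Q, rfl, rfl, contact_imagePoint κ w hγ hE hC hφ hψ Q⟩
    · funext P
      obtain ⟨Q, rfl⟩ := Quot.exists_rep P
      exact hι.apply_mk κ w hγ hE hC hφ hψ Q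
  · intro ι hι
    have hmk := hι.apply_mk κ w hγ hE hC hφ hψ
    refine ⟨fun P P' h => ?_, fun P hP => ?_, fun P hP => ?_, fun P => ?_⟩
    · obtain ⟨p, rfl⟩ := Quot.exists_rep P
      obtain ⟨q, rfl⟩ := Quot.exists_rep P'
      have h' := Tree.mk_eq_mk_iff.1 ((hmk p).symm.trans (h.trans (hmk q)))
      exact Tree.mk_eq_mk_iff.2 (h'.imp (fun h => imagePoint_injective κ w hγ hE hC hφ h)
        (identified_imagePoint_iff κ w hγ hE hC hφ hψ p q).1)
    · obtain ⟨p, rfl⟩ := Quot.exists_rep P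
      exact (congrArg Tree.index (hmk p)).trans ((Tree.index_mk _).trans
        ((indexOn_image hγ hφ hψ p.branch.2.1 (branch_ne_exceptional hE p.branch.2.2)
          (pos_iff_ne_zero.2 hP)).trans (congrArg (w.c * ·) (Tree.index_mk p).symm)))
    · obtain ⟨p, rfl⟩ := Quot.exists_rep P
      have hp : p.exponent = 0 := hP
      constructor
      · refine (congrArg Tree.index (hmk p)).trans ((Tree.index_mk _).trans ?_)
        refine indexOn_image_of_le hγ hφ hψ p.branch.2.1 (branch_ne_exceptional hE p.branch.2.2) ?_
        exact (congrArg w.exponentMap hp).le.trans w.exponentMap_zero.le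
      · refine (Tree.index_mk p).trans (indexOn_eq_one fun q _ => ?_)
        rw [hp]
        exact zero_le
    · obtain ⟨p, rfl⟩ := Quot.exists_rep P
      exact congrArg Tree.exponent (hmk p)
  · intro Aw Bw _
    rw [coincidence_image hγ hφ hψ Aw.2.1 (branch_ne_exceptional hE Aw.2.2) Bw.2.1
      (branch_ne_exceptional hE Bw.2.2), add_comm]
    rfl
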